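/- Let $k$ be a field of characteristic zero and let $V$ be the free pre-Lie algebra over $k$ on a set of generators, realised as the vector space with basis the non-planar rooted trees whose vertices are decorated by the generators; its (left) pre-Lie product $T\triangleright T'$ of two trees is the sum of the trees obtained by grafting the root of $T$ successively onto every vertex of $T'$. Let $k[V]$ be the polynomial algebra on $V$ (with basis the forests), let the brace map $k[V]\otimes V\to V$, $P\otimes v\mapsto\{P\}v$, be defined by $\{1\}v=v$, $\{w\}v=w\triangleright v$ and $$\{w_1\cdots w_n\}v=\{w_n\}(\{w_1\cdots w_{n-1}\}v)-\sum_{i=1}^{n-1}\{w_1\cdots(\{w_n\}w_i)\cdots w_{n-1}\}v,$$ and let $\ast$ be the Grossman–Larson (Oudom–Guin) product on $k[V]$, $$(w_1\cdots w_m)\ast(v_1\cdots v_n)=\sum_f W_0(\{W_1\}v_1)\cdots(\{W_n\}v_n),\qquad W_i=\prod_{j\in f^{-1}(i)}w_j,$$ where $f$ runs over all maps $\{1,\dots,m\}\to\{0,\dots,n\}$. Let $\hat V\subset\widehat{k[V]}$ be the completions of $V$ and $k[V]$ with respect to the grading by the number of vertices, to which the commutative product $\circ$ of polynomials, the product $\ast$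 and the brace map extend. Write $\exp^\circ$ for the exponential series computed with $\circ$, and $\log^\ast$ for the logarithm series $\log^\ast(g)=\sum_{n\ge1}\frac{(-1)^{n-1}}{n}(g-1)^{\ast n}$ computed with $\ast$. Then, for every $x\in\hat V$, the equation $$\Big\{\frac{\Omega}{\exp(\Omega)-1}\Big\}x=\Omega,\qquad \frac{\Omega}{\exp(\Omega)-1}:=\sum_{n\ge0}\frac{B_n}{n!}\,\Omega^{\ast n},\qquad \sum_{n\ge0}\frac{B_n}{n!}z^n=\frac{z}{e^z-1},$$ has exactly one solution $\Omega=\Omega(x)$ in $\hat V$ (the Magnus element of $x$), and $$\Omega(x)=\log^\ast(\exp^\circ(x)).$$ In particular $\log^\ast(\exp^\circ(x))\in\hat V$. -/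

import Mathlib

universe u

/-- Planar rooted trees with vertices decorated by elements of `α`. -/
inductive PlanarTree (α : Type u) : Type u
  | node : α → List (PlanarTree α) → PlanarTree α

namespace PlanarTree

variable {α : Type u}

/-- Two planar trees are isomorphic as (non-planar) decorated rooted trees when their roots carry
the same decoration and the subtrees attached to the roots can be matched bijectively into pairs
of isomorphic trees. -/
inductive Iso : PlanarTree α → PlanarTree α → Prop
  | node {a : α} {l m : List (PlanarTree α)} :
      Multiset.Rel Iso (l : Multiset (PlanarTree α)) (m : Multiset (PlanarTree α)) →
      Iso (.node a l) (.node a m)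

theorem iso_node_iff {a b : α} {l m : List (PlanarTree α)} :
    Iso (.node a l) (.node b m) ↔
      a = b ∧ Multiset.Rel Iso (l : Multiset (PlanarTree α)) (m : Multiset (PlanarTree α)) := by
  constructor
  · rintro ⟨h⟩
    exact ⟨rfl, h⟩
  · rintro ⟨rfl, h⟩
    exact .node h

/-- Induction over the subtrees attached to the root. -/
theorem ind {P : PlanarTree α → Prop}
    (h : ∀ a l, (∀ t ∈ l, P t) → P (.node a l)) : ∀ t, P t
  | .node a l => h a l fun t _ => ind h t

theorem Iso.refl (t : PlanarTree α) : Iso t t := by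
  induction t using ind with
  | h a l ih => exact .node (Multiset.rel_refl_of_refl_on ih)

theorem rel_symm_of {s : Multiset (PlanarTree α)} :
    ∀ {t : Multiset (PlanarTree α)}, (∀ x ∈ s, ∀ y, Iso x y → Iso y x) →
      Multiset.Rel Iso s t → Multiset.Rel Iso t s := by
  induction s using Multiset.induction with
  | empty => intro t _ h; rw [Multiset.rel_zero_left] at h; subst h; exact .zero
  | cons a s ih =>
    intro t hs h
    obtain ⟨b, bs, hab, hbs, rfl⟩ := Multiset.rel_cons_left.1 h
    exact .cons (hs a (by simp) b hab)
      (ih (fun x hx => hs x (by simp [hx])) hbs)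

theorem rel_trans_of {s : Multiset (PlanarTree α)} :
    ∀ {t r : Multiset (PlanarTree α)}, (∀ x ∈ s, ∀ y z, Iso x y → Iso y z → Iso x z) →
      Multiset.Rel Iso s t → Multiset.Rel Iso t r → Multiset.Rel Iso s r := by
  induction s using Multiset.induction with
  | empty =>
    intro t r _ h h'
    rw [Multiset.rel_zero_left] at h; subst h
    exact h'
  | cons a s ih =>
    intro t r hs h h'
    obtain ⟨b, bs, hab, hbs, rfl⟩ := Multiset.rel_cons_left.1 h
    obtain ⟨c, cs, hbc, hcs, rfl⟩ := Multiset.rel_cons_left.1 h'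
    exact .cons (hs a (by simp) b c hab hbc)
      (ih (fun x hx => hs x (by simp [hx])) hbs hcs)

theorem Iso.symm {s t : PlanarTree α} (h : Iso s t) : Iso t s := by
  induction s using ind generalizing t with
  | h a l ih =>
    obtain ⟨b, m⟩ := t
    obtain ⟨rfl, hr⟩ := iso_node_iff.1 h
    exact .node (rel_symm_of (fun x hx y => ih x hx) hr)

theorem Iso.trans {s t r : PlanarTree α} (h : Iso s t) (h' : Iso t r) : Iso s r := by
  induction s using ind generalizing t r with
  | h a l ih =>
    obtain ⟨b, m⟩ := t
    obtain ⟨c, n⟩ := r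
    obtain ⟨rfl, hr⟩ := iso_node_iff.1 h
    obtain ⟨rfl, hr'⟩ := iso_node_iff.1 h'
    exact .node (rel_trans_of (fun x hx y z => ih x hx) hr hr')

instance setoid (α : Type u) : Setoid (PlanarTree α) where
  r := Iso
  iseqv := ⟨Iso.refl, Iso.symm, Iso.trans⟩

/-- The number of vertices of a planar tree. -/
def numVertices : PlanarTree α → ℕ
  | .node _ l => 1 + (l.map numVertices).sum

theorem Iso.numVertices_eq {s t : PlanarTree α} (h : Iso s t) :
    s.numVertices = t.numVertices := by
  induction s using ind generalizing t with
  | h a l ih =>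
    obtain ⟨b, m⟩ := t
    obtain ⟨rfl, hr⟩ := iso_node_iff.1 h
    have key : ∀ {s t : Multiset (PlanarTree α)},
        (∀ x ∈ s, ∀ {y}, Iso x y → x.numVertices = y.numVertices) →
        Multiset.Rel Iso s t → (s.map numVertices).sum = (t.map numVertices).sum := by
      intro s
      induction s using Multiset.induction with
      | empty => intro t _ h; rw [Multiset.rel_zero_left] at h; subst h; rfl
      | cons a s ih' =>
        intro t hs h
        obtain ⟨b, bs, hab, hbs, rfl⟩ := Multiset.rel_cons_left.1 h
        simp [hs a (by simp) hab, ih' (fun x hx => hs x (by simp [hx])) hbs]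
    have := key (fun x hx y => ih x hx) hr
    simpa [numVertices] using this

end PlanarTree

/-- Non-planar rooted trees with vertices decorated by elements of `α`. -/
def DecoratedTree (α : Type u) : Type u := Quotient (PlanarTree.setoid α)

namespace DecoratedTree

variable {α : Type u}

noncomputable instance : DecidableEq (DecoratedTree α) := Classical.decEq _

/-- The number of vertices of a rooted tree. -/
def numVertices : DecoratedTree α → ℕ :=
  Quotient.lift PlanarTree.numVertices fun _ _ h => PlanarTree.Iso.numVertices_eq h

/-- The rooted tree underlying a planar rooted tree. -/
def ofPlanar (t : PlanarTree α) : DecoratedTree α := Quotient.mk (PlanarTree.setoid α) t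

/-- A planar tree representing a rooted tree. -/
noncomputable def toPlanar (t : DecoratedTree α) : PlanarTree α := Quotient.out t

theorem ofPlanar_toPlanar (t : DecoratedTree α) : ofPlanar (toPlanar t) = t := Quotient.out_eq t

theorem ofPlanar_eq_iff {s t : PlanarTree α} : ofPlanar s = ofPlanar t ↔ PlanarTree.Iso s t :=
  Quotient.eq

theorem numVertices_toPlanar (t : DecoratedTree α) : t.toPlanar.numVertices = t.numVertices := by
  conv_rhs => rw [← ofPlanar_toPlanar t]
  rfl

/-- The decoration of the root, together with the multiset of the subtrees attached to it. -/
def unnode : DecoratedTree α → α × Multiset (DecoratedTree α) :=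
  Quotient.lift
    (fun t => match t with
      | .node a l => (a, (l : Multiset (PlanarTree α)).map ofPlanar))
    (by
      rintro ⟨a, l⟩ ⟨b, m⟩ h
      obtain ⟨rfl, hr⟩ := PlanarTree.iso_node_iff.1 h
      have h2 : Multiset.Rel (fun x y => ofPlanar x = ofPlanar y)
          (l : Multiset (PlanarTree α)) (m : Multiset (PlanarTree α)) :=
        hr.mono fun x _ y _ hxy => ofPlanar_eq_iff.2 hxy
      exact Prod.ext rfl (Multiset.rel_eq.1 (Multiset.rel_map.2 h2)))

theorem unnode_ofPlanar (a : α) (l : List (PlanarTree α)) :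
    unnode (ofPlanar (.node a l)) = (a, (l : Multiset (PlanarTree α)).map ofPlanar) := rfl

/-- The decoration of the root. -/
def root (t : DecoratedTree α) : α := t.unnode.1

/-- The multiset of the subtrees attached to the root. -/
def children (t : DecoratedTree α) : Multiset (DecoratedTree α) := t.unnode.2

/-- The rooted tree obtained by attaching the trees of `F` to a root decorated by `a`. -/
noncomputable def node (a : α) (F : Multiset (DecoratedTree α)) : DecoratedTree α :=
  ofPlanar (.node a (F.toList.map toPlanar))

theorem unnode_node (a : α) (F : Multiset (DecoratedTree α)) : unnode (node a F) = (a, F) := by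
  rw [node, unnode_ofPlanar, ← Multiset.map_coe, Multiset.map_map, Multiset.coe_toList]
  simp [ofPlanar_toPlanar]

@[simp] theorem root_node (a : α) (F : Multiset (DecoratedTree α)) : root (node a F) = a := by
  simp [root, unnode_node]

@[simp] theorem children_node (a : α) (F : Multiset (DecoratedTree α)) :
    children (node a F) = F := by
  simp [children, unnode_node]

theorem unnode_injective : Function.Injective (unnode (α := α)) := by
  intro s t h
  rw [← ofPlanar_toPlanar s, ← ofPlanar_toPlanar t] at h ⊢
  generalize s.toPlanar = s at h ⊢
  generalize t.toPlanar = t at h ⊢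
  obtain ⟨a, l⟩ := s
  obtain ⟨b, m⟩ := t
  rw [unnode_ofPlanar, unnode_ofPlanar, Prod.mk.injEq] at h
  obtain ⟨rfl, h⟩ := h
  refine ofPlanar_eq_iff.2 (PlanarTree.Iso.node ?_)
  rw [← Multiset.rel_eq, Multiset.rel_map] at h
  exact h.mono fun x _ y _ hxy => ofPlanar_eq_iff.1 hxy

theorem node_unnode (t : DecoratedTree α) : node t.root t.children = t :=
  unnode_injective (unnode_node _ _)

theorem numVertices_node (a : α) (F : Multiset (DecoratedTree α)) :
    (node a F).numVertices = 1 + (F.map numVertices).sum := by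
  change PlanarTree.numVertices (.node a (F.toList.map toPlanar)) = _
  rw [PlanarTree.numVertices, List.map_map]
  conv_rhs => rw [← Multiset.coe_toList F]
  simp [numVertices_toPlanar, Function.comp_def]

theorem numVertices_eq (t : DecoratedTree α) :
    t.numVertices = 1 + (t.children.map numVertices).sum := by
  conv_lhs => rw [← node_unnode t, numVertices_node]

theorem numVertices_pos (t : DecoratedTree α) : 0 < t.numVertices := by
  rw [numVertices_eq]; omega

theorem numVertices_lt_of_mem_children {c t : DecoratedTree α} (h : c ∈ t.children) :
    c.numVertices < t.numVertices := by
  rw [numVertices_eq t]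
  have := Multiset.single_le_sum (s := t.children.map numVertices) (by simp) _
    (Multiset.mem_map_of_mem _ h)
  omega

/-- Induction over the subtrees attached to the root. -/
theorem ind {P : DecoratedTree α → Prop}
    (h : ∀ a F, (∀ t ∈ F, P t) → P (node a F)) (t : DecoratedTree α) : P t := by
  induction hn : t.numVertices using Nat.strong_induction_on generalizing t with
  | h n ih =>
    subst hn
    rw [← node_unnode t]
    exact h _ _ fun c hc => ih _ (numVertices_lt_of_mem_children hc) c rfl

/-- The multiset of the trees obtained by grafting the root of `t` onto a vertex of `s`, where the
vertex runs over all vertices of `s`: it is either the root of `s`, or a vertex of one of the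
subtrees `c` attached to the root, in which case `c` is replaced by the grafted tree. -/
noncomputable def graft (t s : DecoratedTree α) : Multiset (DecoratedTree α) :=
  node s.root (t ::ₘ s.children) ::ₘ
    s.children.attach.bind fun c =>
      (graft t c.1).map fun c' => node s.root (c' ::ₘ s.children.erase c.1)
termination_by s.numVertices
decreasing_by exact numVertices_lt_of_mem_children c.2

theorem graft_node (t : DecoratedTree α) (a : α) (F : Multiset (DecoratedTree α)) :
    graft t (node a F) = node a (t ::ₘ F) ::ₘ
      F.bind fun c => (graft t c).map fun c' => node a (c' ::ₘ F.erase c) := by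
  rw [graft, Multiset.attach_bind_coe (node a F).children fun c =>
    (graft t c).map fun c' => node (node a F).root (c' ::ₘ (node a F).children.erase c)]
  simp only [root_node, children_node]

theorem numVertices_of_mem_graft {t s r : DecoratedTree α} (h : r ∈ graft t s) :
    r.numVertices = t.numVertices + s.numVertices := by
  induction s using ind generalizing r with
  | h a F ih =>
    rw [graft_node, Multiset.mem_cons] at h
    rcases h with rfl | h
    · simp only [numVertices_node, Multiset.map_cons, Multiset.sum_cons]; omega
    · obtain ⟨c, hc, h⟩ := Multiset.mem_bind.1 h
      obtain ⟨c', hc', rfl⟩ := Multiset.mem_map.1 h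
      have h1 := ih c hc hc'
      have h2 : (F.map numVertices).sum = c.numVertices + ((F.erase c).map numVertices).sum := by
        conv_lhs => rw [← Multiset.cons_erase hc]
        simp
      simp only [numVertices_node, Multiset.map_cons, Multiset.sum_cons]; omega

end DecoratedTree

namespace LeftPreLieRing

variable {L : Type*} [LeftPreLieRing L]

/-- The brace `{w₁, …, wₙ} v` of elements of a left pre-Lie ring, in terms of the list
`[wₙ, …, w₁]`; the pre-Lie product `x ▷ y` is written `x * y`. -/
def braceList : List L → L → L
  | [], v => v
  | w :: ws, v =>
      w * braceList ws v - ∑ i : Fin ws.length, braceList (ws.set i (w * ws[i])) v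
termination_by ws => ws.length

/-- The sum of the values of `f` on the lists obtained by replacing one entry `a` by `g a`. -/
def sumReplace {A M : Type*} [AddCommMonoid M] (g : A → A) : (List A → M) → List A → M
  | _, [] => 0
  | f, a :: l => f (g a :: l) + sumReplace g (fun l' => f (a :: l')) l

theorem sumReplace_eq {A M : Type*} [AddCommMonoid M] (g : A → A) (l : List A) :
    ∀ f : List A → M,
      ∑ i : Fin l.length, f (l.set i (g l[i])) = sumReplace g f l := by
  induction l with
  | nil => intro f; simp [sumReplace]
  | cons a l ih =>
    intro f
    rw [sumReplace, ← ih]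
    exact Fin.sum_univ_succ _

theorem braceList_cons (w : L) (ws : List L) (v : L) :
    braceList (w :: ws) v =
      w * braceList ws v - sumReplace (fun a => w * a) (fun l => braceList l v) ws := by
  rw [braceList, ← sumReplace_eq (fun a => w * a) ws (fun l => braceList l v)]

/-- Additivity in every entry on lists of length `n`. -/
def EntryAdditive (n : ℕ) (f : List L → L) : Prop :=
  ∀ l₁ l₂ : List L, ∀ a b : L, l₁.length + l₂.length + 1 = n →
    f (l₁ ++ (a + b) :: l₂) = f (l₁ ++ a :: l₂) + f (l₁ ++ b :: l₂)

theorem EntryAdditive.cons {n : ℕ} {f : List L → L} (hf : EntryAdditive (n + 1) f) (a : L) :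
    EntryAdditive n (fun l => f (a :: l)) := by
  intro l₁ l₂ x y h
  exact hf (a :: l₁) l₂ x y (by simp; omega)

theorem sumReplace_add_fun (g : L → L) (l : List L) :
    ∀ f f' : List L → L,
      sumReplace g (fun l => f l + f' l) l = sumReplace g f l + sumReplace g f' l := by
  induction l with
  | nil => intro f f'; simp [sumReplace]
  | cons a l ih => intro f f'; simp only [sumReplace, ih]; abel

theorem sumReplace_sub_fun (g : L → L) (l : List L) :
    ∀ f f' : List L → L,
      sumReplace g (fun l => f l - f' l) l = sumReplace g f l - sumReplace g f' l := by
  induction l with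
  | nil => intro f f'; simp [sumReplace]
  | cons a l ih => intro f f'; simp only [sumReplace, ih]; abel

theorem sumReplace_mul (u : L) (g : L → L) (l : List L) :
    ∀ f : List L → L, sumReplace g (fun l => u * f l) l = u * sumReplace g f l := by
  induction l with
  | nil => intro f; simp [sumReplace]
  | cons a l ih => intro f; simp only [sumReplace, ih, mul_add]

theorem sumReplace_add (g g' : L → L) (l : List L) :
    ∀ f : List L → L, EntryAdditive l.length f →
      sumReplace (fun a => g a + g' a) f l = sumReplace g f l + sumReplace g' f l := by
  induction l with
  | nil => intro f _; simp [sumReplace]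
  | cons a l ih =>
    intro f hf
    simp only [sumReplace]
    have h := hf [] l (g a) (g' a) (by simp)
    simp only [List.nil_append] at h
    rw [ih _ (EntryAdditive.cons hf a), h]
    abel

theorem EntryAdditive.sumReplace (u : L) :
    ∀ (n : ℕ) (f : List L → L), EntryAdditive n f →
      EntryAdditive n (sumReplace (fun a => u * a) f) := by
  intro n
  induction n with
  | zero => intro f _ l₁ l₂ a b h; omega
  | succ n ih =>
    intro f hf l₁ l₂ a b h
    cases l₁ with
    | nil =>
      have key : ∀ l : List L, ∀ f : List L → L → L,
          (∀ l' : List L, l'.length = l.length → f l' (a + b) = f l' a + f l' b) →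
          LeftPreLieRing.sumReplace (fun a => u * a) (fun l => f l (a + b)) l =
            LeftPreLieRing.sumReplace (fun a => u * a) (fun l => f l a) l +
            LeftPreLieRing.sumReplace (fun a => u * a) (fun l => f l b) l := by
        intro l
        induction l with
        | nil => intro f _; simp [LeftPreLieRing.sumReplace]
        | cons c l ihl =>
          intro f hf
          simp only [LeftPreLieRing.sumReplace]
          rw [hf _ (by simp), ihl (fun l x => f (c :: l) x) (fun l' hl' => hf _ (by simp [hl']))]
          abel
      have hl : l₂.length = n := by simpa using h
      have h0 := hf [] l₂ (u * a) (u * b) (by simp [hl])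
      simp only [List.nil_append] at h0
      simp only [List.nil_append, LeftPreLieRing.sumReplace, mul_add]
      rw [h0, key l₂ (fun l x => f (x :: l)) (fun l' hl' => hf [] l' a b (by simp [hl', hl]))]
      abel
    | cons c l₁ =>
      simp only [List.cons_append, LeftPreLieRing.sumReplace]
      rw [ih _ (EntryAdditive.cons hf c) l₁ l₂ a b (by simp at h; omega)]
      have := hf (u * c :: l₁) l₂ a b h
      simp only [List.cons_append] at this
      rw [this]
      abel

theorem sumReplace_congr (g : L → L) (l : List L) :
    ∀ f f' : List L → L, (∀ l' : List L, l'.length = l.length → f l' = f' l') →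
      sumReplace g f l = sumReplace g f' l := by
  induction l with
  | nil => intro f f' _; simp [sumReplace]
  | cons a l ih =>
    intro f f' h
    simp only [sumReplace]
    rw [h _ (by simp), ih _ _ fun l' hl' => h _ (by simp [hl'])]

theorem entryAdditive_braceList (v : L) :
    ∀ n : ℕ, EntryAdditive n (fun l : List L => braceList l v) := by
  intro n
  induction n with
  | zero => intro l₁ l₂ a b h; omega
  | succ n ih =>
    intro l₁ l₂ a b h
    cases l₁ with
    | nil =>
      have hl : l₂.length = n := by simpa using h
      simp only [List.nil_append, braceList_cons, add_mul]
      rw [sumReplace_add _ _ _ _ (by rw [hl]; exact ih)]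
      abel
    | cons c l₁ =>
      simp only [List.cons_append, braceList_cons]
      have h' : l₁.length + l₂.length + 1 = n := by simp at h; omega
      have h0 := ih l₁ l₂ a b h'
      simp only at h0
      rw [h0, EntryAdditive.sumReplace c n _ ih l₁ l₂ a b h', mul_add]
      abel

theorem assoc_symm_eq (x y z : L) : x * y * z + y * (x * z) = y * x * z + x * (y * z) := by
  have h := LeftPreLieRing.assoc_symm x y z
  simp only [associator_apply] at h
  rw [sub_eq_sub_iff_add_eq_add] at h
  exact h

theorem sumReplace_symm (w u : L) (l : List L) :
    ∀ f : List L → L, EntryAdditive l.length f →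
      sumReplace (fun a => w * u * a) f l +
          sumReplace (fun a => w * a) (sumReplace (fun a => u * a) f) l =
        sumReplace (fun a => u * w * a) f l +
          sumReplace (fun a => u * a) (sumReplace (fun a => w * a) f) l := by
  induction l with
  | nil => intro f _; simp [sumReplace]
  | cons a l ih =>
    intro f hf
    simp only [sumReplace, sumReplace_add_fun]
    have h1 := ih _ (EntryAdditive.cons hf a)
    have h2 : f (w * u * a :: l) + f (u * (w * a) :: l) =
        f (u * w * a :: l) + f (w * (u * a) :: l) := by
      have e1 := hf [] l (w * u * a) (u * (w * a)) (by simp)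
      have e2 := hf [] l (u * w * a) (w * (u * a)) (by simp)
      simp only [List.nil_append] at e1 e2
      rw [← e1, ← e2, assoc_symm_eq]
    have h3 := congrArg₂ (· + ·) h1 h2
    rw [← sub_eq_zero] at h3 ⊢
    rw [← h3]
    abel

theorem braceList_swap (w u : L) (l : List L) (v : L) :
    braceList (w :: u :: l) v = braceList (u :: w :: l) v := by
  have key : ∀ w u : L, braceList (w :: u :: l) v =
      w * (u * braceList l v) - w * u * braceList l v
        - w * sumReplace (fun a => u * a) (fun l => braceList l v) l
        - u * sumReplace (fun a => w * a) (fun l => braceList l v) l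
        + (sumReplace (fun a => w * u * a) (fun l => braceList l v) l
        + sumReplace (fun a => w * a)
            (sumReplace (fun a => u * a) (fun l => braceList l v)) l) := by
    intro w u
    rw [braceList_cons w, sumReplace, braceList_cons u, braceList_cons (w * u)]
    simp only [braceList_cons u, sumReplace_sub_fun, sumReplace_mul, mul_sub]
    abel
  rw [key w u, key u w, sumReplace_symm w u l _ (entryAdditive_braceList v _)]
  have h := assoc_symm_eq w u (braceList l v)
  rw [← sub_eq_zero] at h ⊢
  rw [← neg_zero, ← h]
  abel

theorem sumReplace_perm (g : L → L) {l l' : List L} (h : l.Perm l') :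
    ∀ f : List L → L,
      (∀ l₁ l₂ : List L, l₁.length = l.length → l₁.Perm l₂ → f l₁ = f l₂) →
      sumReplace g f l = sumReplace g f l' := by
  induction h with
  | nil => intro f _; rfl
  | cons a h ih =>
    intro f hf
    simp only [sumReplace]
    rw [hf _ _ (by simp) (h.cons (g a)),
      ih _ fun l₁ l₂ hl hp => hf _ _ (by simp [hl]) (hp.cons a)]
  | swap a b l =>
    intro f hf
    simp only [sumReplace]
    rw [hf (g b :: a :: l) _ (by simp) (List.Perm.swap a (g b) l),
      hf (b :: g a :: l) _ (by simp) (List.Perm.swap (g a) b l),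
      sumReplace_congr g l (fun l' => f (b :: a :: l')) (fun l' => f (a :: b :: l'))
        fun l' hl' => hf _ _ (by simp [hl']) (List.Perm.swap a b l')]
    abel
  | trans h₁ h₂ ih₁ ih₂ =>
    intro f hf
    rw [ih₁ f hf, ih₂ f fun l₁ l₂ hl hp => hf l₁ l₂ (hl.trans h₁.length_eq.symm) hp]

theorem braceList_perm (v : L) {l l' : List L} (h : l.Perm l') :
    braceList l v = braceList l' v := by
  induction hn : l.length using Nat.strong_induction_on generalizing l l' with
  | h n ih =>
    induction h with
    | nil => rfl
    | cons a h _ =>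
      rw [braceList_cons, braceList_cons, ih _ (by rw [← hn]; simp) h rfl,
        sumReplace_perm _ h _ fun l₁ l₂ hl hp => ih _ (by rw [← hn, hl]; simp) hp rfl]
    | swap a b l => exact braceList_swap b a l v
    | trans h₁ h₂ ih₁ ih₂ => rw [ih₁ hn, ih₂ (by rw [← h₁.length_eq, hn])]

/-- The brace `{w₁ ⋯ wₙ} v`, which does not depend on the order of the `wᵢ`. -/
def brace (W : Multiset L) (v : L) : L :=
  Quotient.lift (fun l => braceList l v) (fun _ _ h => braceList_perm v h) W

@[simp] theorem brace_coe (l : List L) (v : L) : brace (l : Multiset L) v = braceList l v := rfl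

@[simp] theorem brace_zero (v : L) : brace 0 v = v := by
  rw [← Multiset.coe_nil, brace_coe, braceList]

@[simp] theorem brace_singleton (w v : L) : brace {w} v = w * v := by
  rw [← Multiset.coe_singleton, brace_coe, braceList_cons, braceList, sumReplace, sub_zero]

end LeftPreLieRing

/-- The vector space with basis the (non-planar) rooted trees decorated by `α`. With the grafting
product below this is the free pre-Lie algebra on the set `α` of generators. -/
def TreePreLie (k : Type*) [Field k] (α : Type*) : Type _ := DecoratedTree α →₀ k

namespace TreePreLie

open DecoratedTree

variable {k : Type*} [Field k] {α : Type*}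

noncomputable instance : AddCommGroup (TreePreLie k α) :=
  inferInstanceAs (AddCommGroup (DecoratedTree α →₀ k))

noncomputable instance : Module k (TreePreLie k α) :=
  inferInstanceAs (Module k (DecoratedTree α →₀ k))

/-- The basis of rooted trees. -/
noncomputable def treeBasis (k : Type*) [Field k] (α : Type*) :
    Module.Basis (DecoratedTree α) k (TreePreLie k α) :=
  .ofRepr (LinearEquiv.refl k (DecoratedTree α →₀ k))

/-- The grafting product: on trees, `t ▷ s` is the sum of the trees obtained by grafting the root
of `t` successively onto every vertex of `s`. -/
noncomputable def graftHom (k : Type*) [Field k] (α : Type*) :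
    TreePreLie k α →ₗ[k] TreePreLie k α →ₗ[k] TreePreLie k α :=
  (treeBasis k α).constr k fun t => (treeBasis k α).constr k fun s =>
    ((graft t s).map (treeBasis k α)).sum

theorem graftHom_basis (t s : DecoratedTree α) :
    graftHom k α (treeBasis k α t) (treeBasis k α s) = ((graft t s).map (treeBasis k α)).sum := by
  simp [graftHom, Module.Basis.constr_basis]

theorem basis_induction {P : TreePreLie k α → Prop} (hb : ∀ t, P (treeBasis k α t))
    (h0 : P 0) (hadd : ∀ x y, P x → P y → P (x + y)) (hsmul : ∀ (c : k) x, P x → P (c • x))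
    (x : TreePreLie k α) : P x := by
  have hx : x ∈ Submodule.span k (Set.range (treeBasis k α)) := by
    rw [(treeBasis k α).span_eq]; trivial
  induction hx using Submodule.span_induction with
  | mem x h => obtain ⟨t, rfl⟩ := h; exact hb t
  | zero => exact h0
  | add x y _ _ hx hy => exact hadd x y hx hy
  | smul c x _ hx => exact hsmul c x hx

/-- The inclusion of `V` into the polynomial algebra `k[V]`, which is the polynomial algebra in
the variables given by the basis of `V`. -/
noncomputable def toPoly (k : Type*) [Field k] (α : Type*) :
    TreePreLie k α →ₗ[k] MvPolynomial (DecoratedTree α) k :=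
  (treeBasis k α).constr k MvPolynomial.X

@[simp] theorem toPoly_basis (t : DecoratedTree α) :
    toPoly k α (treeBasis k α t) = MvPolynomial.X t := by
  simp [toPoly, Module.Basis.constr_basis]

/-- The monomial of a forest. -/
noncomputable def forest (k : Type*) [Field k] {α : Type*} (F : Multiset (DecoratedTree α)) :
    MvPolynomial (DecoratedTree α) k :=
  (F.map MvPolynomial.X).prod

theorem forest_eq (F : Multiset (DecoratedTree α)) :
    forest k F = MvPolynomial.monomial (Multiset.toFinsupp F) 1 := by
  induction F using Multiset.induction with
  | empty => simp [forest]
  | cons t F ih =>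
    have h : forest k (t ::ₘ F) = MvPolynomial.X t * forest k F := by simp [forest]
    rw [h, ih, MvPolynomial.X, MvPolynomial.monomial_mul, ← Multiset.singleton_add, map_add,
      Multiset.toFinsupp_singleton, one_mul]

theorem forest_cons (t : DecoratedTree α) (F : Multiset (DecoratedTree α)) :
    forest k (t ::ₘ F) = MvPolynomial.X t * forest k F := by
  simp [forest]

theorem poly_induction {P : MvPolynomial (DecoratedTree α) k → Prop}
    (hf : ∀ F, P (forest k F))
    (hadd : ∀ p q, P p → P q → P (p + q)) (hsmul : ∀ (c : k) p, P p → P (c • p))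
    (p : MvPolynomial (DecoratedTree α) k) : P p := by
  induction p using MvPolynomial.induction_on' with
  | monomial u a =>
    have h := hsmul a _ (hf (Finsupp.toMultiset u))
    rw [forest_eq, Finsupp.toMultiset_toFinsupp, MvPolynomial.smul_monomial, smul_eq_mul,
      mul_one] at h
    exact h
  | add p q hp hq => exact hadd p q hp hq

/-- Attaching the trees of a forest to a new root decorated by `a`, extended linearly. -/
noncomputable def addRoot (k : Type*) [Field k] {α : Type*} (a : α) :
    MvPolynomial (DecoratedTree α) k →ₗ[k] TreePreLie k α :=
  (MvPolynomial.basisMonomials (DecoratedTree α) k).constr k fun u =>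
    treeBasis k α (node a (Finsupp.toMultiset u))

theorem addRoot_forest (a : α) (F : Multiset (DecoratedTree α)) :
    addRoot k a (forest k F) = treeBasis k α (node a F) := by
  have h : forest k F
      = MvPolynomial.basisMonomials (DecoratedTree α) k (Multiset.toFinsupp F) := by
    rw [forest_eq, MvPolynomial.coe_basisMonomials]
  rw [h, addRoot, Module.Basis.constr_basis, Multiset.toFinsupp_toMultiset]

/-- The derivation of `k[V]` which extends the grafting of `x`. -/
noncomputable def graftDer (x : TreePreLie k α) :
    Derivation k (MvPolynomial (DecoratedTree α) k) (MvPolynomial (DecoratedTree α) k) :=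
  MvPolynomial.mkDerivation k fun t => toPoly k α (graftHom k α x (treeBasis k α t))

theorem graftDer_X (x : TreePreLie k α) (t : DecoratedTree α) :
    graftDer x (MvPolynomial.X t) = toPoly k α (graftHom k α x (treeBasis k α t)) :=
  MvPolynomial.mkDerivation_X _ _ _

theorem graftDer_toPoly (x v : TreePreLie k α) :
    graftDer x (toPoly k α v) = toPoly k α (graftHom k α x v) := by
  induction v using basis_induction with
  | hb t => rw [toPoly_basis, graftDer_X]
  | h0 => simp
  | hadd v w hv hw => simp [hv, hw]
  | hsmul c v hv => simp [hv]

theorem graftDer_add (x y : TreePreLie k α) : graftDer (x + y) = graftDer x + graftDer y :=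
  MvPolynomial.derivation_ext fun t => by simp [graftDer_X]

theorem graftDer_smul (c : k) (x : TreePreLie k α) : graftDer (c • x) = c • graftDer x :=
  MvPolynomial.derivation_ext fun t => by simp [graftDer_X]

theorem graftDer_forest (x : TreePreLie k α) (F : Multiset (DecoratedTree α)) :
    graftDer x (forest k F) =
      (F.map fun c => toPoly k α (graftHom k α x (treeBasis k α c)) *
        forest k (F.erase c)).sum := by
  induction F using Multiset.induction with
  | empty => simp [forest]
  | cons t F ih =>
    rw [forest_cons, Derivation.leibniz, ih, graftDer_X, Multiset.map_cons, Multiset.sum_cons,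
      Multiset.erase_cons_head, smul_eq_mul, smul_eq_mul, add_comm,
      ← Multiset.sum_map_mul_left, mul_comm]
    congr 2
    refine Multiset.map_congr rfl fun c hc => ?_
    rw [Multiset.erase_cons_tail_of_mem hc, forest_cons]
    ring

theorem graftHom_addRoot (x : TreePreLie k α) (a : α) (p : MvPolynomial (DecoratedTree α) k) :
    graftHom k α x (addRoot k a p) = addRoot k a (toPoly k α x * p + graftDer x p) := by
  induction x using basis_induction with
  | h0 =>
    have : graftDer (0 : TreePreLie k α) = 0 :=
      MvPolynomial.derivation_ext fun t => by simp [graftDer_X]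
    simp [this]
  | hadd x y hx hy =>
    simp only [map_add, LinearMap.add_apply, hx, hy, graftDer_add, Derivation.add_apply, add_mul]
    abel
  | hsmul c x hx =>
    simp only [map_smul, LinearMap.smul_apply, hx, graftDer_smul, Derivation.smul_apply,
      smul_mul_assoc, smul_add, map_add]
  | hb t =>
    induction p using poly_induction with
    | hadd p q hp hq => simp only [map_add, hp, hq, mul_add]; abel
    | hsmul c p hp =>
      simp only [map_smul, hp, mul_smul_comm, map_add, smul_add, Derivation.map_smul]
    | hf F =>
      rw [addRoot_forest, graftHom_basis, graft_node, Multiset.map_cons, Multiset.sum_cons,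
        map_add, toPoly_basis, ← forest_cons, addRoot_forest, graftDer_forest,
        Multiset.map_bind, Multiset.sum_bind, map_multiset_sum, Multiset.map_map]
      congr 2
      refine Multiset.map_congr rfl fun c _ => ?_
      rw [Function.comp_apply, graftHom_basis, map_multiset_sum, Multiset.map_map,
        ← Multiset.sum_map_mul_right, map_multiset_sum, Multiset.map_map, Multiset.map_map]
      refine congrArg _ (Multiset.map_congr rfl fun c' _ => ?_)
      simp only [Function.comp_apply, toPoly_basis, ← forest_cons, addRoot_forest]

theorem graftHom_symm (x y z : TreePreLie k α) :
    graftHom k α (graftHom k α x y) z - graftHom k α x (graftHom k α y z) =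
      graftHom k α (graftHom k α y x) z - graftHom k α y (graftHom k α x z) := by
  induction z using basis_induction with
  | h0 => simp
  | hadd z w hz hw =>
    simp only [map_add]
    rw [add_sub_add_comm, hz, hw, add_sub_add_comm]
  | hsmul c z hz => simp only [map_smul, ← smul_sub, hz]
  | hb t =>
    induction t using DecoratedTree.ind with
    | h a F ih =>
      have key : graftDer x (graftDer y (forest k F)) - graftDer y (graftDer x (forest k F)) =
          graftDer (graftHom k α x y) (forest k F) -
            graftDer (graftHom k α y x) (forest k F) := by
        induction F using Multiset.induction with
        | empty => simp [forest]
        | cons t F ihF =>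
          have h1 := ihF fun t ht => ih t (by simp [ht])
          have h2 := congrArg (toPoly k α) (ih t (by simp))
          simp only [map_sub] at h2
          simp only [forest_cons, Derivation.leibniz, map_add, smul_eq_mul, graftDer_X,
            graftDer_toPoly]
          generalize toPoly k α (graftHom k α (graftHom k α x y) (treeBasis k α t)) = a1 at h2 ⊢
          generalize toPoly k α (graftHom k α (graftHom k α y x) (treeBasis k α t)) = a2 at h2 ⊢
          generalize toPoly k α (graftHom k α x (graftHom k α y (treeBasis k α t))) = a3 at h2 ⊢
          generalize toPoly k α (graftHom k α y (graftHom k α x (treeBasis k α t))) = a4 at h2 ⊢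
          generalize graftDer x (graftDer y (forest k F)) = b1 at h1 ⊢
          generalize graftDer y (graftDer x (forest k F)) = b2 at h1 ⊢
          generalize graftDer (graftHom k α x y) (forest k F) = b3 at h1 ⊢
          generalize graftDer (graftHom k α y x) (forest k F) = b4 at h1 ⊢
          linear_combination (MvPolynomial.X t) * h1 - forest k F * h2
      rw [← addRoot_forest]
      simp only [graftHom_addRoot]
      rw [← map_sub, ← map_sub]
      refine congrArg (addRoot k a) ?_
      simp only [map_add, Derivation.leibniz, smul_eq_mul, graftDer_toPoly]
      generalize graftDer x (graftDer y (forest k F)) = b1 at key ⊢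
      generalize graftDer y (graftDer x (forest k F)) = b2 at key ⊢
      generalize graftDer (graftHom k α x y) (forest k F) = b3 at key ⊢
      generalize graftDer (graftHom k α y x) (forest k F) = b4 at key ⊢
      linear_combination - key

noncomputable instance : LeftPreLieRing (TreePreLie k α) where
  mul x y := graftHom k α x y
  left_distrib x y z := map_add (graftHom k α x) y z
  right_distrib x y z := by
    change graftHom k α (x + y) z = graftHom k α x z + graftHom k α y z
    simp
  zero_mul x := by
    change graftHom k α 0 x = 0
    simp
  mul_zero x := map_zero (graftHom k α x)
  assoc_symm' x y z := graftHom_symm x y z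

theorem mul_def (x y : TreePreLie k α) : x * y = graftHom k α x y := rfl

noncomputable instance : LeftPreLieAlgebra k (TreePreLie k α) where
  smul_assoc c x y := by
    change graftHom k α (c • x) y = c • graftHom k α x y
    simp
  smul_comm c x y := by
    change c • graftHom k α x y = graftHom k α x (c • y)
    simp

end TreePreLie

namespace LeftPreLieRing

/-- The brace is compatible with gradings of the pre-Lie algebra. -/
theorem braceList_mem {L k : Type*} [LeftPreLieRing L] [Ring k] [Module k L]
    (V : ℕ → Submodule k L)
    (hV : ∀ m n x y, x ∈ V m → y ∈ V n → x * y ∈ V (m + n)) {N : ℕ} {v : L} (hv : v ∈ V N) :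
    ∀ (n : ℕ) (ws : List L) (ds : List ℕ), ws.length = n →
      List.Forall₂ (fun w d => w ∈ V d) ws ds → braceList ws v ∈ V (ds.sum + N) := by
  have key : ∀ (M d : ℕ) (w : L), w ∈ V d → ∀ (ws : List L) (ds : List ℕ) (f : List L → L)
      (e : ℕ), List.Forall₂ (fun w d => w ∈ V d) ws ds →
      (∀ ws' ds', ws'.length = ws.length → List.Forall₂ (fun w d => w ∈ V d) ws' ds' →
        ds'.sum + e = M → f ws' ∈ V M) →
      d + ds.sum + e = M → sumReplace (fun a => w * a) f ws ∈ V M := by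
    intro M d w hw ws
    induction ws with
    | nil => intro ds f e _ _ _; exact zero_mem _
    | cons a ws ih =>
      intro ds f e h hf hM
      cases h with
      | @cons _ b _ ds ha h =>
        simp only [sumReplace]
        refine add_mem (hf _ ((d + b) :: ds) (by simp) (.cons (hV _ _ _ _ hw ha) h) ?_) ?_
        · simp only [List.sum_cons] at hM ⊢; omega
        · refine ih ds _ (b + e) h (fun ws' ds' hl h' hs => ?_) ?_
          · refine hf _ (b :: ds') (by simp [hl]) (.cons ha h') ?_
            simp only [List.sum_cons]; omega
          · simp only [List.sum_cons] at hM; omega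
  intro n
  induction n with
  | zero =>
    intro ws ds hn h
    obtain rfl := List.length_eq_zero_iff.1 hn
    cases h
    simpa [braceList] using hv
  | succ n ih =>
    intro ws ds hn h
    cases h with
    | nil => simp at hn
    | @cons w d ws ds hw h =>
      have hn' : ws.length = n := by simpa using hn
      rw [braceList_cons]
      refine sub_mem ?_ ?_
      · have := hV _ _ _ _ hw (ih ws ds hn' h)
        rwa [← add_assoc, ← List.sum_cons] at this
      · refine key _ d w hw ws ds _ N h (fun ws' ds' hl h' hs => ?_) (by simp)
        rw [← hs]
        exact ih ws' ds' (hl.trans hn') h'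

end LeftPreLieRing

namespace TreePreLie

open DecoratedTree

variable {k : Type*} [Field k] {α : Type*}

/-- The component `V_n` of `V` spanned by the trees with `n` vertices. -/
noncomputable def gradedPiece (k : Type*) [Field k] (α : Type*) (n : ℕ) :
    Submodule k (TreePreLie k α) :=
  Submodule.span k (treeBasis k α '' {t | t.numVertices = n})

/-- The component `k[V]_n` of `k[V]` spanned by the forests with `n` vertices. -/
noncomputable abbrev polyGradedPiece (k : Type*) [Field k] (α : Type*) (n : ℕ) :
    Submodule k (MvPolynomial (DecoratedTree α) k) :=
  MvPolynomial.weightedHomogeneousSubmodule k numVertices n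

theorem basis_mem (t : DecoratedTree α) :
    treeBasis k α t ∈ gradedPiece k α t.numVertices :=
  Submodule.subset_span ⟨t, rfl, rfl⟩

/-- The grafting product respects the grading. -/
theorem mul_mem_gradedPiece (m n : ℕ) (x y : TreePreLie k α) (hx : x ∈ gradedPiece k α m)
    (hy : y ∈ gradedPiece k α n) : x * y ∈ gradedPiece k α (m + n) := by
  rw [mul_def]
  induction hx, hy using Submodule.span_induction₂ with
  | mem_mem x y hx hy =>
    obtain ⟨t, rfl, rfl⟩ := hx
    obtain ⟨s, rfl, rfl⟩ := hy
    rw [graftHom_basis]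
    refine multiset_sum_mem _ fun z hz => ?_
    obtain ⟨r, hr, rfl⟩ := Multiset.mem_map.1 hz
    rw [← numVertices_of_mem_graft hr]
    exact basis_mem r
  | zero_left y hy => simp
  | zero_right x hx => simp
  | add_left x y z _ _ _ h1 h2 => simpa using add_mem h1 h2
  | add_right x y z _ _ _ h1 h2 => simpa using add_mem h1 h2
  | smul_left c x y _ _ h => simpa using Submodule.smul_mem _ c h
  | smul_right c x y _ _ h => simpa using Submodule.smul_mem _ c h

theorem toPoly_mem {n : ℕ} {v : TreePreLie k α} (hv : v ∈ gradedPiece k α n) :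
    toPoly k α v ∈ polyGradedPiece k α n := by
  induction hv using Submodule.span_induction with
  | mem x h =>
    obtain ⟨t, rfl, rfl⟩ := h
    rw [toPoly_basis]
    exact MvPolynomial.isWeightedHomogeneous_X k _ t
  | zero => simp
  | add x y _ _ hx hy => simpa using add_mem hx hy
  | smul c x _ hx => simpa using Submodule.smul_mem _ c hx

theorem forestBrace_mem (F : Multiset (DecoratedTree α)) (t : DecoratedTree α) :
    LeftPreLieRing.brace (F.map (treeBasis k α)) (treeBasis k α t) ∈
      gradedPiece k α ((F.map numVertices).sum + t.numVertices) := by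
  induction F using Quotient.inductionOn with
  | h l =>
    have h := LeftPreLieRing.braceList_mem (gradedPiece k α) mul_mem_gradedPiece (basis_mem t)
      _ (l.map (treeBasis k α)) (l.map numVertices) rfl (by
        rw [List.forall₂_map_left_iff, List.forall₂_map_right_iff, List.forall₂_same]
        exact fun s _ => basis_mem s)
    exact h

/-- The brace map `k[V] ⊗ V → V`, `P ⊗ v ↦ {P} v`. -/
noncomputable def braceHom (k : Type*) [Field k] (α : Type*) :
    MvPolynomial (DecoratedTree α) k →ₗ[k] TreePreLie k α →ₗ[k] TreePreLie k α :=
  (MvPolynomial.basisMonomials (DecoratedTree α) k).constr k fun F =>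
    (treeBasis k α).constr k fun t =>
      LeftPreLieRing.brace ((Finsupp.toMultiset F).map (treeBasis k α)) (treeBasis k α t)

open Classical in
/-- The product `(w₁ ⋯ wₘ) ∗ (v₁ ⋯ vₙ) = ∑_f W₀ ({W₁} v₁) ⋯ ({Wₙ} vₙ)` for families `w` and `v`
of elements of `V`, where `f` runs over the maps from `{1, …, m}` to `{0, 1, …, n}` and `Wᵢ` is the
product of the `wⱼ` with `f j = i`. The families are indexed by finite types `ι` and `κ`, and
`none` plays the role of the value `0` of `f`. -/
noncomputable def familyStar {ι κ : Type*} [Fintype ι] [Fintype κ]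
    (w : ι → TreePreLie k α) (v : κ → TreePreLie k α) : MvPolynomial (DecoratedTree α) k :=
  ∑ f : ι → Option κ,
    (∏ j with f j = none, toPoly k α (w j)) *
      ∏ i, toPoly k α
        (LeftPreLieRing.brace ((Finset.univ.filter fun j => f j = some i).val.map w) (v i))

/-- The product `A ∗ B` of two forests, in terms of enumerations of the trees of `A` and `B`; by
`familyStar_eq_forestStar` the enumerations do not matter. -/
noncomputable def forestStar (k : Type*) [Field k] {α : Type*}
    (A B : Multiset (DecoratedTree α)) : MvPolynomial (DecoratedTree α) k :=
  familyStar (fun j : Fin A.toList.length => treeBasis k α A.toList[j])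
    (fun i : Fin B.toList.length => treeBasis k α B.toList[i])

theorem familyStar_reindex {ι κ ι' κ' : Type*} [Fintype ι] [Fintype κ] [Fintype ι'] [Fintype κ']
    (e : ι ≃ ι') (e' : κ ≃ κ') (w : ι' → TreePreLie k α) (v : κ' → TreePreLie k α) :
    familyStar (w ∘ e) (v ∘ e') = familyStar w v := by
  classical
  unfold familyStar
  refine Fintype.sum_equiv (Equiv.arrowCongr e (Equiv.optionCongr e')) _ _ fun f => ?_
  congr 1
  · refine Finset.prod_equiv e (fun j => ?_) fun j _ => rfl
    simp
  · refine Fintype.prod_equiv e' _ _ fun i => ?_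
    congr 2
    rw [← Multiset.map_map, ← Function.Embedding.coeFn_mk e e.injective, ← Finset.map_val]
    congr 2
    ext j
    simp only [Finset.mem_map, Finset.mem_filter, Finset.mem_univ, true_and]
    constructor
    · rintro ⟨a, h, rfl⟩
      simp [h]
    · intro h
      refine ⟨e.symm j, ?_, by simp⟩
      simpa [Equiv.symm_apply_eq] using h

theorem exists_equiv {β ι κ : Type*} [Fintype ι] [Fintype κ] (w : ι → β) (v : κ → β)
    (h : Finset.univ.val.map w = Finset.univ.val.map v) : ∃ e : ι ≃ κ, w = v ∘ e := by
  classical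
  have hc : ∀ b, Nonempty ({j // w j = b} ≃ {i // v i = b}) := by
    intro b
    refine Fintype.card_eq.1 ?_
    have h1 := congrArg (Multiset.count b) h
    rw [Multiset.count_map, Multiset.count_map] at h1
    rw [Fintype.card_subtype, Fintype.card_subtype, Finset.card_def, Finset.card_def,
      Finset.filter_val, Finset.filter_val]
    simpa only [eq_comm] using h1
  refine ⟨Equiv.ofFiberEquiv (f := w) (g := v) fun b => (hc b).some, ?_⟩
  funext j
  exact (Equiv.ofFiberEquiv_map _ j).symm

theorem map_univ_getElem {β : Type*} (F : Multiset β) :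
    (Finset.univ : Finset (Fin F.toList.length)).val.map (fun i => F.toList[i]) = F := by
  rw [Fin.univ_val_map]
  exact (congrArg _ List.ofFn_getElem).trans (Multiset.coe_toList F)

theorem familyStar_eq_forestStar {ι κ : Type*} [Fintype ι] [Fintype κ]
    (w : ι → DecoratedTree α) (v : κ → DecoratedTree α) :
    familyStar (treeBasis k α ∘ w) (treeBasis k α ∘ v) =
      forestStar k (Finset.univ.val.map w) (Finset.univ.val.map v) := by
  obtain ⟨e, he⟩ := exists_equiv w _ (map_univ_getElem (Finset.univ.val.map w)).symm
  obtain ⟨e', he'⟩ := exists_equiv v _ (map_univ_getElem (Finset.univ.val.map v)).symm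
  rw [forestStar, ← familyStar_reindex e e']
  conv_lhs => rw [he, he']
  rfl

/-- The Grossman–Larson (Oudom–Guin) product `∗` on `k[V]`. -/
noncomputable def starHom (k : Type*) [Field k] (α : Type*) :
    MvPolynomial (DecoratedTree α) k →ₗ[k] MvPolynomial (DecoratedTree α) k →ₗ[k]
      MvPolynomial (DecoratedTree α) k :=
  (MvPolynomial.basisMonomials (DecoratedTree α) k).constr k fun A =>
    (MvPolynomial.basisMonomials (DecoratedTree α) k).constr k fun B =>
      forestStar k (Finsupp.toMultiset A) (Finsupp.toMultiset B)

theorem braceHom_forest (F : Multiset (DecoratedTree α)) (t : DecoratedTree α) :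
    braceHom k α (forest k F) (treeBasis k α t) =
      LeftPreLieRing.brace (F.map (treeBasis k α)) (treeBasis k α t) := by
  have h : forest k F
      = MvPolynomial.basisMonomials (DecoratedTree α) k (Multiset.toFinsupp F) := by
    rw [forest_eq, MvPolynomial.coe_basisMonomials]
  rw [h, braceHom, Module.Basis.constr_basis, Module.Basis.constr_basis,
    Multiset.toFinsupp_toMultiset]

theorem starHom_forest (A B : Multiset (DecoratedTree α)) :
    starHom k α (forest k A) (forest k B) = forestStar k A B := by
  have h : ∀ F : Multiset (DecoratedTree α), forest k F
      = MvPolynomial.basisMonomials (DecoratedTree α) k (Multiset.toFinsupp F) := by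
    intro F
    rw [forest_eq, MvPolynomial.coe_basisMonomials]
  rw [h, h, starHom, Module.Basis.constr_basis, Module.Basis.constr_basis,
    Multiset.toFinsupp_toMultiset, Multiset.toFinsupp_toMultiset]

theorem forest_mem (F : Multiset (DecoratedTree α)) :
    forest k F ∈ polyGradedPiece k α (F.map numVertices).sum := by
  induction F using Multiset.induction with
  | empty => simpa [forest] using MvPolynomial.isWeightedHomogeneous_one k numVertices
  | cons t F ih =>
    rw [forest_cons, Multiset.map_cons, Multiset.sum_cons]
    exact (MvPolynomial.isWeightedHomogeneous_X k _ t).mul ih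

/-- The homogeneous components of `k[V]` are spanned by forests. -/
theorem polyGradedPiece_induction {n : ℕ} {P : MvPolynomial (DecoratedTree α) k → Prop}
    (hf : ∀ F : Multiset (DecoratedTree α), (F.map numVertices).sum = n → P (forest k F))
    (h0 : P 0) (hadd : ∀ p q, P p → P q → P (p + q)) (hsmul : ∀ (c : k) p, P p → P (c • p))
    {p : MvPolynomial (DecoratedTree α) k} (hp : p ∈ polyGradedPiece k α n) : P p := by
  rw [p.as_sum]
  refine Finset.sum_induction _ P hadd h0 fun u hu => ?_
  have h1 : Finsupp.weight numVertices u = n := hp (MvPolynomial.mem_support_iff.1 hu)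
  have h3 : ∀ u : DecoratedTree α →₀ ℕ,
      ((Finsupp.toMultiset u).map numVertices).sum = Finsupp.weight numVertices u := by
    intro u
    induction u using Finsupp.induction_linear with
    | zero => simp
    | add u v hu hv => simp only [map_add, Multiset.map_add, Multiset.sum_add, hu, hv]
    | single t n =>
      simp [Finsupp.toMultiset_single, Multiset.map_nsmul, Multiset.sum_nsmul,
        Finsupp.weight_apply]
  have h2 := hsmul (p.coeff u) _ (hf (Finsupp.toMultiset u) ((h3 u).trans h1))
  rw [forest_eq, Finsupp.toMultiset_toFinsupp, MvPolynomial.smul_monomial, smul_eq_mul,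
    mul_one] at h2
  exact h2

end TreePreLie

namespace TreePreLie

open DecoratedTree

variable {k : Type*} [Field k] {α : Type*}

theorem braceHom_mem {m n : ℕ} {p : MvPolynomial (DecoratedTree α) k} {v : TreePreLie k α}
    (hp : p ∈ polyGradedPiece k α m) (hv : v ∈ gradedPiece k α n) :
    braceHom k α p v ∈ gradedPiece k α (m + n) := by
  refine polyGradedPiece_induction (P := fun p => braceHom k α p v ∈ gradedPiece k α (m + n))
    ?_ (by simp) (fun p q hp hq => by simpa using add_mem hp hq)
    (fun c p hp => by simpa using Submodule.smul_mem _ c hp) hp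
  rintro F rfl
  induction hv using Submodule.span_induction with
  | mem x h =>
    obtain ⟨t, rfl, rfl⟩ := h
    rw [braceHom_forest]
    exact forestBrace_mem F t
  | zero => simp
  | add x y _ _ hx hy => simpa using add_mem hx hy
  | smul c x _ hx => simpa using Submodule.smul_mem _ c hx

theorem forestStar_mem (A B : Multiset (DecoratedTree α)) :
    forestStar k A B ∈ polyGradedPiece k α ((A.map numVertices).sum + (B.map numVertices).sum) := by
  classical
  have hs : ∀ F : Multiset (DecoratedTree α),
      ∑ j : Fin F.toList.length, numVertices F.toList[j] = (F.map numVertices).sum := by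
    intro F
    conv_rhs => rw [← map_univ_getElem F, Multiset.map_map]
    rfl
  rw [forestStar, familyStar]
  refine sum_mem fun f _ => ?_
  have h1 := MvPolynomial.IsWeightedHomogeneous.prod (w := numVertices)
    (Finset.univ.filter fun j : Fin A.toList.length => f j = none)
    (fun j => toPoly k α (treeBasis k α A.toList[j]))
    (fun j => numVertices A.toList[j]) fun j _ => toPoly_mem (basis_mem _)
  have h2 := MvPolynomial.IsWeightedHomogeneous.prod (w := numVertices) Finset.univ
    (fun i : Fin B.toList.length => toPoly k α (LeftPreLieRing.brace
        ((Finset.univ.filter fun j : Fin A.toList.length => f j = some i).val.map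
          fun j => treeBasis k α A.toList[j])
        (treeBasis k α B.toList[i])))
    (fun i => (∑ j : Fin A.toList.length with f j = some i, numVertices A.toList[j]) +
      numVertices B.toList[i]) fun i _ => by
      have h := toPoly_mem (forestBrace_mem (k := k)
        ((Finset.univ.filter fun j : Fin A.toList.length => f j = some i).val.map
          fun j => A.toList[j]) B.toList[i])
      simp only [Multiset.map_map, Function.comp_def] at h
      exact h
  have h3 : (∑ j : Fin A.toList.length with f j = none, numVertices A.toList[j]) +
      ∑ i : Fin B.toList.length,
        ((∑ j : Fin A.toList.length with f j = some i, numVertices A.toList[j]) +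
          numVertices B.toList[i]) =
      (A.map numVertices).sum + (B.map numVertices).sum := by
    rw [Finset.sum_add_distrib, ← add_assoc, hs, ← hs A,
      ← Finset.sum_fiberwise Finset.univ f, Fintype.sum_option]
  rw [← h3]
  exact (MvPolynomial.mem_weightedHomogeneousSubmodule _ _ _ _).2 (by convert h1.mul h2)

theorem starHom_mem {m n : ℕ} {p q : MvPolynomial (DecoratedTree α) k}
    (hp : p ∈ polyGradedPiece k α m) (hq : q ∈ polyGradedPiece k α n) :
    starHom k α p q ∈ polyGradedPiece k α (m + n) := by
  refine polyGradedPiece_induction (P := fun p => starHom k α p q ∈ polyGradedPiece k α (m + n))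
    ?_ (by simp) (fun p q hp hq => by simpa using add_mem hp hq)
    (fun c p hp => by simpa using Submodule.smul_mem _ c hp) hp
  rintro A rfl
  refine polyGradedPiece_induction
    (P := fun q => starHom k α (forest k A) q ∈
      polyGradedPiece k α ((A.map numVertices).sum + n))
    ?_ (by simp) (fun p q hp hq => by simpa using add_mem hp hq)
    (fun c p hp => by simpa using Submodule.smul_mem _ c hp) hq
  rintro B rfl
  rw [starHom_forest]
  exact forestStar_mem A B

/-- The completion of `V` with respect to the number of vertices. -/
abbrev Completion (k : Type*) [Field k] (α : Type*) : Type _ :=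
  ∀ n : ℕ, gradedPiece k α n

/-- The completion of `k[V]` with respect to the number of vertices. -/
abbrev PolyCompletion (k : Type*) [Field k] (α : Type*) : Type _ :=
  ∀ n : ℕ, polyGradedPiece k α n

/-- The inclusion of the completion of `V` into the completion of `k[V]`. -/
noncomputable def Completion.toPoly (x : Completion k α) : PolyCompletion k α :=
  fun n => ⟨TreePreLie.toPoly k α (x n), toPoly_mem (x n).2⟩

/-- The brace map on the completions. -/
noncomputable def Completion.brace (P : PolyCompletion k α) (x : Completion k α) :
    Completion k α :=
  fun n => ⟨∑ p ∈ Finset.HasAntidiagonal.antidiagonal n, braceHom k α (P p.1) (x p.2), sum_mem fun p hp => by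
    rw [← Finset.HasAntidiagonal.mem_antidiagonal.1 hp]
    exact braceHom_mem (P p.1).2 (x p.2).2⟩

namespace PolyCompletion

/-- The unit of both products. -/
noncomputable def unit (k : Type*) [Field k] (α : Type*) : PolyCompletion k α :=
  Pi.single 0 ⟨1, MvPolynomial.isWeightedHomogeneous_one k numVertices⟩

/-- The commutative product of polynomials, on the completion. -/
noncomputable def circ (P Q : PolyCompletion k α) : PolyCompletion k α :=
  fun n => ⟨∑ p ∈ Finset.HasAntidiagonal.antidiagonal n,
      (P p.1 : MvPolynomial (DecoratedTree α) k) * (Q p.2 : MvPolynomial (DecoratedTree α) k),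
    sum_mem fun p hp => by
      rw [← Finset.HasAntidiagonal.mem_antidiagonal.1 hp]
      exact (P p.1).2.mul (Q p.2).2⟩

/-- The product `∗` of the enveloping algebra, on the completion. -/
noncomputable def star (P Q : PolyCompletion k α) : PolyCompletion k α :=
  fun n => ⟨∑ p ∈ Finset.HasAntidiagonal.antidiagonal n, starHom k α (P p.1) (Q p.2), sum_mem fun p hp => by
    rw [← Finset.HasAntidiagonal.mem_antidiagonal.1 hp]
    exact starHom_mem (P p.1).2 (Q p.2).2⟩

/-- The powers of an element for a product `μ`. -/
noncomputable def power (μ : PolyCompletion k α → PolyCompletion k α → PolyCompletion k α)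
    (P : PolyCompletion k α) : ℕ → PolyCompletion k α
  | 0 => unit k α
  | n + 1 => μ (power μ P n) P

/-- The value `∑ₙ φₙ Pⁿ` of a formal power series `φ` at an element `P` without component of
degree `0`, with powers taken for a product `μ`, either `circ` or `star`. As `Pⁿ` has no component
of degree `< n`, the sum is finite in each degree. -/
noncomputable def evalSeries
    (μ : PolyCompletion k α → PolyCompletion k α → PolyCompletion k α) (φ : PowerSeries k)
    (P : PolyCompletion k α) : PolyCompletion k α :=
  fun m => ∑ n ∈ Finset.range (m + 1), PowerSeries.coeff n φ • power μ P n m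

/-- In the situation of `evalSeries`, the omitted terms vanish. -/
theorem power_eq_zero {P : PolyCompletion k α} (hP : P 0 = 0) {n m : ℕ} (h : m < n) :
    power circ P n m = 0 ∧ power star P n m = 0 := by
  induction n generalizing m with
  | zero => omega
  | succ n ih =>
    have h (p : ℕ × ℕ) (hp : p ∈ Finset.HasAntidiagonal.antidiagonal m) :
        P p.2 = 0 ∨ power circ P n p.1 = 0 ∧ power star P n p.1 = 0 := by
      have hp' := Finset.HasAntidiagonal.mem_antidiagonal.1 hp
      by_cases h0 : p.2 = 0
      · exact Or.inl (h0 ▸ hP)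
      · exact Or.inr (ih (by omega))
    refine ⟨Subtype.ext ?_, Subtype.ext ?_⟩
    · change ∑ p ∈ Finset.HasAntidiagonal.antidiagonal m, _ = _
      refine Finset.sum_eq_zero fun p hp => ?_
      rcases h p hp with h0 | h0
      · rw [h0]; simp
      · rw [h0.1]; simp
    · change ∑ p ∈ Finset.HasAntidiagonal.antidiagonal m, _ = _
      refine Finset.sum_eq_zero fun p hp => ?_
      rcases h p hp with h0 | h0
      · rw [h0]; simp
      · rw [h0.2]; simp

/-- Trees have at least one vertex. -/
theorem toPoly_zero (x : Completion k α) : x.toPoly 0 = 0 := by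
  have h : gradedPiece k α 0 = ⊥ := by
    rw [gradedPiece, Submodule.span_eq_bot]
    rintro _ ⟨t, ht, rfl⟩
    exact absurd ht (numVertices_pos t).ne'
  have h2 : (x 0 : TreePreLie k α) = 0 := by
    exact (Submodule.mem_bot k).1 (h ▸ (x 0).2)
  exact Subtype.ext (by simp [Completion.toPoly, h2])

variable [CharZero k]

/-- The exponential for the commutative product. -/
noncomputable def expCirc (P : PolyCompletion k α) : PolyCompletion k α :=
  evalSeries circ (PowerSeries.exp k) P

/-- The logarithm for the product `∗`: `PowerSeries.log` is the series of `log (1 + X)`. -/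
noncomputable def logStar (P : PolyCompletion k α) : PolyCompletion k α :=
  evalSeries star (PowerSeries.log k) (P - unit k α)

end PolyCompletion

variable [CharZero k]

/-- `Ω` solves `{Ω / (exp Ω - 1)} x = Ω`, where `Ω / (exp Ω - 1)` is the value at `Ω`, for the
product `∗`, of the series `X / (exp X - 1) = ∑ₙ Bₙ / n! Xⁿ`. -/
def IsMagnusElement (x Ω : Completion k α) : Prop :=
  Completion.brace (PolyCompletion.evalSeries PolyCompletion.star (bernoulliPowerSeries k)
    Ω.toPoly) x = Ω

end TreePreLie

/-! ### The brace recursion in terms of multisets and indexed families -/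

namespace LeftPreLieRing

variable {L : Type*} [LeftPreLieRing L]

/-! Everything rests on left multiplication by elements of $V$. For $w \in V$ let $D_w$ be the
derivation of $k[V]$ extending $w \triangleright \cdot$, and let `leftMul w` be $Q \mapsto wQ + D_w
Q$. The defining formulas give $w \ast Q = wQ + D_w Q$ (`starHom_toPoly`), $\{w \ast Q\}v = w
\triangleright \{Q\}v$ (`braceHom_leftMul`) and $(w \ast A) \ast B = w \ast (A \ast B)$
(`starHom_leftMul`). This much associativity suffices, because only series in one element $\Omega$
of $\hat V$ occur: with $M = \Omega \ast \cdot$ and $L = \Omega \triangleright \cdot$ on the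
completions, the value of a series $\varphi$ at $\Omega$ is $\varphi(M)1$, and $\{\varphi(\Omega)\}x
= \varphi(L)x$. Both operators raise degrees, so power series in them make sense and multiply as
usual.

The Magnus equation thus reads $\frac{L}{e^L-1}x = \Omega$, that is, $x = \frac{e^L-1}{L}\Omega$.
What remains is the identity $e^M 1 = \exp^\circ\bigl(\frac{e^L-1}{L}\Omega\bigr)$,
`evalPowerSeries_exp_starLeft`. It is a differential equation in an auxiliary variable $t$: if $y' =
\Omega + Dy$ and $y(0) = 0$, with $D = D_\Omega$, then $y = \sum_n D^n\Omega\, t^{n+1}/(n+1)!$.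
Since $\partial_t - D$ is a derivation, $E = \exp^\circ(y)$ satisfies $E' = \Omega E + DE$ and $E(0)
= 1$, the equation that determines $e^{tM}1$. Setting $t = 1$ gives the identity, since $D$
restricts to $L$ on $\hat V$. Hence $\exp^\circ(x)$ is the exponential of $\Omega$ for $\ast$, and
$\log^\ast$ recovers $\Omega$ because $\log(1 + (e^X - 1)) = X$.

Existence and uniqueness are separate: since $x$ has no component of degree $0$, the degree $d$ part
of the left side of the equation involves only components of $\Omega$ of degree $< d$, so
`exists_unique_fixedPoint` applies. -/

theorem brace_cons (w : L) (W : Multiset L) (v : L) [DecidableEq L] :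
    brace (w ::ₘ W) v = w * brace W v - (W.map fun c => brace ((w * c) ::ₘ W.erase c) v).sum := by
  induction W using Quotient.inductionOn with
  | h l =>
    -- `sumReplace` passes the entries before the replaced one into the function; when that function
    -- depends only on the multiset, they are absorbed as `a ::ₘ ·` and their position is
    -- irrelevant.
    have key : ∀ (l : List L) (f : Multiset L → L),
        sumReplace (fun a => w * a) (fun l' => f (l' : Multiset L)) l =
          ((l : Multiset L).map fun c => f ((w * c) ::ₘ (l : Multiset L).erase c)).sum := by
      intro l
      induction l with
      | nil => intro f; simp [sumReplace]
      | cons a l ih =>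
        intro f
        have h := ih fun W => f (a ::ₘ W)
        simp only [Multiset.cons_coe] at h
        rw [sumReplace, h, ← Multiset.cons_coe a l, Multiset.map_cons, Multiset.sum_cons,
          Multiset.erase_cons_head, Multiset.cons_coe]
        refine congrArg _ (congrArg _ (Multiset.map_congr rfl fun c hc => ?_))
        rw [Multiset.erase_cons_tail_of_mem hc, Multiset.cons_swap]
    change braceList (w :: l) v = w * braceList l v - _
    rw [braceList_cons]
    exact congrArg _ (key l fun W => brace W v)

theorem brace_cons_add (x y : L) (W : Multiset L) (v : L) :
    brace ((x + y) ::ₘ W) v = brace (x ::ₘ W) v + brace (y ::ₘ W) v := by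
  induction W using Quotient.inductionOn with
  | h l => exact entryAdditive_braceList v (l.length + 1) [] l x y (by simp)

/-- The brace as an additive map in one of its entries. -/
def braceConsHom (W : Multiset L) (v : L) : L →+ L :=
  AddMonoidHom.mk' (fun x => brace (x ::ₘ W) v) fun x y => brace_cons_add x y W v

@[simp] theorem braceConsHom_apply (W : Multiset L) (v x : L) :
    braceConsHom W v x = brace (x ::ₘ W) v := rfl

/-- Indexing the entries keeps equal ones apart, as the maps $f$ in the definition of `familyStar`
require; deleting an index deletes one copy of its value. -/
theorem brace_cons_map {ι : Type*} [DecidableEq ι] (a : L) (s : Finset ι) (w : ι → L) (v : L) :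
    brace (a ::ₘ s.val.map w) v = a * brace (s.val.map w) v -
      ∑ j ∈ s, brace ((a * w j) ::ₘ (s.erase j).val.map w) v := by
  classical
  rw [brace_cons, Multiset.map_map]
  refine congrArg _ (congrArg _ (Multiset.map_congr rfl fun j hj => ?_))
  have h : s.val.map w = w j ::ₘ (s.erase j).val.map w := by
    rw [← Multiset.map_cons, Finset.erase_val, Multiset.cons_erase hj]
  rw [Function.comp_apply, h, Multiset.erase_cons_head]

end LeftPreLieRing

/-! ### Left multiplication by elements of $V$ and its action through the brace -/

namespace TreePreLie

open DecoratedTree LeftPreLieRing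

variable {k : Type*} [Field k] {α : Type*}

/-- `braceHom` and `starHom` are given by explicit formulas on forests only, while $t \triangleright
s$ is a sum of trees. As its coefficients are natural numbers, identities known on trees extend to
it by additivity alone, without $k$-linearity of the brace in its entries. -/
theorem addMonoidHom_graft_eq {M : Type*} [AddCommMonoid M] {f g : TreePreLie k α →+ M}
    (h : ∀ t, f (treeBasis k α t) = g (treeBasis k α t)) (t s : DecoratedTree α) :
    f (graftHom k α (treeBasis k α t) (treeBasis k α s)) =
      g (graftHom k α (treeBasis k α t) (treeBasis k α s)) := by
  rw [graftHom_basis, map_multiset_sum, map_multiset_sum, Multiset.map_map, Multiset.map_map]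
  exact congrArg _ (Multiset.map_congr rfl fun r _ => h r)

/-- The operator `Q ↦ w ∗ Q` of left multiplication by an element of `V`. -/
noncomputable def leftMul (w : TreePreLie k α) :
    MvPolynomial (DecoratedTree α) k →ₗ[k] MvPolynomial (DecoratedTree α) k :=
  LinearMap.mulLeft k (toPoly k α w) + (graftDer w : _ →ₗ[k] _)

theorem leftMul_apply (w : TreePreLie k α) (Q : MvPolynomial (DecoratedTree α) k) :
    leftMul w Q = toPoly k α w * Q + graftDer w Q := rfl

theorem leftMul_one (w : TreePreLie k α) : leftMul w 1 = toPoly k α w := by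
  simp [leftMul_apply]

theorem leftMul_add (x y : TreePreLie k α) : leftMul (x + y) = leftMul x + leftMul y := by
  refine LinearMap.ext fun Q => ?_
  simp only [leftMul_apply, graftDer_add, add_mul, map_add, LinearMap.add_apply,
    Derivation.add_apply]
  abel

theorem leftMul_smul (c : k) (x : TreePreLie k α) : leftMul (c • x) = c • leftMul x := by
  refine LinearMap.ext fun Q => ?_
  simp [leftMul_apply, graftDer_smul]

theorem leftMul_zero : leftMul (0 : TreePreLie k α) = 0 := by
  simpa using leftMul_smul (0 : k) (0 : TreePreLie k α)

theorem braceHom_one (v : TreePreLie k α) : braceHom k α 1 v = v := by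
  induction v using basis_induction with
  | h0 => simp
  | hadd x y hx hy => rw [map_add, hx, hy]
  | hsmul c x hx => rw [map_smul, hx]
  | hb t => simpa [forest] using braceHom_forest (k := k) 0 t

/-- This is the brace recursion: on a forest, the Leibniz rule for `graftDer` produces exactly the
sum that the recursion subtracts. It makes $V$ a module under the left multiplications. -/
theorem braceHom_leftMul (w v : TreePreLie k α) (Q : MvPolynomial (DecoratedTree α) k) :
    braceHom k α (leftMul w Q) v = w * braceHom k α Q v := by
  classical
  induction w using basis_induction with
  | h0 => simp [leftMul_zero]
  | hadd x y hx hy => simp [leftMul_add, hx, hy, add_mul]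
  | hsmul c x hx => simp [leftMul_smul, hx, smul_mul_assoc]
  | hb t =>
    induction Q using poly_induction with
    | hadd p q hp hq => simp [hp, hq, mul_add]
    | hsmul c p hp => simp [hp, mul_smul_comm]
    | hf F =>
      induction v using basis_induction with
      | h0 => simp
      | hadd x y hx hy => simp [hx, hy, mul_add]
      | hsmul c x hx => simp [hx, mul_smul_comm]
      | hb s =>
        -- The formula of `braceHom_forest`, with one of the trees replaced by the sum of trees $t
        -- \triangleright c$.
        have h1 : ∀ (W : Multiset (DecoratedTree α)) (c : DecoratedTree α),
            braceHom k α (toPoly k α (graftHom k α (treeBasis k α t) (treeBasis k α c)) *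
              forest k W) (treeBasis k α s) =
            brace ((treeBasis k α t * treeBasis k α c) ::ₘ W.map (treeBasis k α))
              (treeBasis k α s) := by
          intro W c
          refine addMonoidHom_graft_eq
            (f := ((((braceHom k α).flip (treeBasis k α s)) ∘ₗ
              LinearMap.mulRight k (forest k W) ∘ₗ toPoly k α : _ →ₗ[k] _) : _ →+ _))
            (g := braceConsHom (W.map (treeBasis k α)) (treeBasis k α s)) (fun r => ?_) t c
          have h := braceHom_forest (k := k) (r ::ₘ W) s
          rw [forest_cons, Multiset.map_cons] at h
          simpa using h
        rw [leftMul_apply, map_add, LinearMap.add_apply, graftDer_forest, toPoly_basis,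
          ← forest_cons, braceHom_forest, braceHom_forest, Multiset.map_cons, brace_cons,
          ← LinearMap.flip_apply (braceHom k α), map_multiset_sum, Multiset.map_map,
          Multiset.map_map, sub_add_eq_add_sub, add_sub_assoc, add_eq_left,
          sub_eq_zero]
        refine congrArg _ (Multiset.map_congr rfl fun c hc => ?_)
        simp only [Function.comp_apply, LinearMap.flip_apply]
        rw [h1, Multiset.map_erase_of_mem _ _ hc]

/-! ### Dependence of the product $\ast$ on one entry of its left factor -/

section familyStar

variable {ι κ : Type*} [Fintype ι] [Fintype κ] [DecidableEq ι] [DecidableEq κ]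

/-- Replaces the classical decidability instances in the definition by the ambient ones. -/
theorem familyStar_eq_sum (w : ι → TreePreLie k α) (v : κ → TreePreLie k α) :
    familyStar w v = ∑ f : ι → Option κ, (∏ j with f j = none, toPoly k α (w j)) *
      ∏ i, toPoly k α (brace ((Finset.univ.filter fun j => f j = some i).val.map w) (v i)) := by
  rw [familyStar]
  refine Finset.sum_congr (by congr!) fun f _ => ?_
  congr!

/-- The contribution of a map `f` to `familyStar`, as an additive function of the value `x` of the
first family at the index `j`. -/
noncomputable def familyTerm (w : ι → TreePreLie k α) (v : κ → TreePreLie k α) (f : ι → Option κ)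
    (j : ι) : TreePreLie k α →+ MvPolynomial (DecoratedTree α) k :=
  match f j with
  | none => (AddMonoidHom.mulRight ((∏ j' ∈ (Finset.univ.filter fun j => f j = none).erase j,
        toPoly k α (w j')) *
      ∏ i, toPoly k α (brace ((Finset.univ.filter fun j => f j = some i).val.map w) (v i)))).comp
        (toPoly k α).toAddMonoidHom
  | some i => (AddMonoidHom.mulRight ((∏ j with f j = none, toPoly k α (w j)) *
      ∏ i' ∈ Finset.univ.erase i, toPoly k α
        (brace ((Finset.univ.filter fun j => f j = some i').val.map w) (v i')))).comp
        ((toPoly k α).toAddMonoidHom.comp (braceConsHom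
          (((Finset.univ.filter fun j => f j = some i).erase j).val.map w) (v i)))

theorem familyTerm_of_none (w : ι → TreePreLie k α) (v : κ → TreePreLie k α) (f : ι → Option κ)
    (j : ι) (h : f j = none) (x : TreePreLie k α) :
    familyTerm w v f j x = toPoly k α x *
      ((∏ j' ∈ (Finset.univ.filter fun j => f j = none).erase j, toPoly k α (w j')) *
      ∏ i, toPoly k α
        (brace ((Finset.univ.filter fun j => f j = some i).val.map w) (v i))) := by
  unfold familyTerm
  split
  · rfl
  · simp_all

theorem familyTerm_of_some (w : ι → TreePreLie k α) (v : κ → TreePreLie k α) (f : ι → Option κ)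
    (j : ι) (i : κ) (h : f j = some i) (x : TreePreLie k α) :
    familyTerm w v f j x = toPoly k α (brace (x ::ₘ
        ((Finset.univ.filter fun j => f j = some i).erase j).val.map w) (v i)) *
      ((∏ j with f j = none, toPoly k α (w j)) *
      ∏ i' ∈ Finset.univ.erase i, toPoly k α
        (brace ((Finset.univ.filter fun j => f j = some i').val.map w) (v i'))) := by
  unfold familyTerm
  split
  · simp_all
  · rename_i i' h'
    obtain rfl : i = i' := by simpa [h] using h'
    rfl

omit [Fintype ι] in
theorem map_update_of_notMem {β : Type*} (w : ι → β) {j : ι} (x : β) {s : Finset ι} (h : j ∉ s) :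
    s.val.map (Function.update w j x) = s.val.map w :=
  Multiset.map_congr rfl fun j' hj' => Function.update_of_ne (by rintro rfl; exact h hj') _ _

omit [Fintype ι] in
theorem map_update_of_mem {β : Type*} (w : ι → β) {j : ι} (x : β) {s : Finset ι} (h : j ∈ s) :
    s.val.map (Function.update w j x) = x ::ₘ (s.erase j).val.map w := by
  have h' : s.val = j ::ₘ (s.erase j).val := by
    rw [Finset.erase_val, Multiset.cons_erase h]
  rw [h', Multiset.map_cons, Function.update_self, map_update_of_notMem _ _ (by simp)]

/-- In the term of $f$ the entry with index $j$ occurs in a single factor: in $W_0$ if `f j = none`,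
and in the brace of $v_i$ if `f j = some i`. The other factors do not see the update. -/
theorem familyStar_update (w : ι → TreePreLie k α) (v : κ → TreePreLie k α) (j : ι)
    (x : TreePreLie k α) :
    familyStar (Function.update w j x) v = ∑ f : ι → Option κ, familyTerm w v f j x := by
  rw [familyStar_eq_sum]
  refine Finset.sum_congr rfl fun f _ => ?_
  rcases h : f j with _ | i
  · have h1 : ∏ j' with f j' = none, toPoly k α (Function.update w j x j') = toPoly k α x *
        ∏ j' ∈ (Finset.univ.filter fun j => f j = none).erase j, toPoly k α (w j') := by
      rw [← Finset.mul_prod_erase (Finset.univ.filter fun j => f j = none)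
        (fun j' => toPoly k α (Function.update w j x j')) (a := j) (by simp [h]),
        Function.update_self]
      exact congrArg _ (Finset.prod_congr rfl fun j' hj' => by
        rw [Function.update_of_ne (Finset.ne_of_mem_erase hj')])
    rw [familyTerm_of_none _ _ _ _ h, h1, mul_assoc]
    refine congrArg _ (congrArg _ (Finset.prod_congr rfl fun i _ => ?_))
    rw [map_update_of_notMem _ _ (by simp [h])]
  · have h1 : ∏ i', toPoly k α (brace ((Finset.univ.filter fun j => f j = some i').val.map
          (Function.update w j x)) (v i')) = toPoly k α (brace (x ::ₘ
          ((Finset.univ.filter fun j => f j = some i).erase j).val.map w) (v i)) *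
        ∏ i' ∈ Finset.univ.erase i, toPoly k α
          (brace ((Finset.univ.filter fun j => f j = some i').val.map w) (v i')) := by
      rw [← Finset.mul_prod_erase Finset.univ _ (Finset.mem_univ i),
        map_update_of_mem _ _ (by simp [h])]
      refine congrArg _ (Finset.prod_congr rfl fun i' hi' => ?_)
      rw [map_update_of_notMem]
      simpa [h] using (Finset.ne_of_mem_erase hi').symm
    have h2 : ∏ j' with f j' = none, toPoly k α (Function.update w j x j') =
        ∏ j' with f j' = none, toPoly k α (w j') :=
      Finset.prod_congr rfl fun j' hj' => by
        rw [Function.update_of_ne]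
        rintro rfl
        simp [h] at hj'
    rw [familyTerm_of_some _ _ _ _ _ h, h1, h2, mul_left_comm]

end familyStar

end TreePreLie

/-! ### Associativity of $\ast$ when the leftmost factor lies in $V$ -/

namespace TreePreLie

open DecoratedTree LeftPreLieRing

variable {k : Type*} [Field k] {α : Type*}

theorem derivation_prod {R A ι : Type*} [CommSemiring R] [CommRing A] [Algebra R A]
    [DecidableEq ι] (D : Derivation R A A) (s : Finset ι) (f : ι → A) :
    D (∏ i ∈ s, f i) = ∑ i ∈ s, D (f i) * ∏ i' ∈ s.erase i, f i' := by
  induction s using Finset.induction_on with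
  | empty => simp
  | insert a s ha ih =>
    rw [Finset.prod_insert ha, Derivation.leibniz, ih, Finset.sum_insert ha,
      Finset.erase_insert ha, smul_eq_mul, smul_eq_mul, Finset.mul_sum, add_comm, mul_comm]
    refine congrArg _ (Finset.sum_congr rfl fun i hi => ?_)
    have hne : a ≠ i := by rintro rfl; exact ha hi
    rw [Finset.erase_insert_of_ne hne, Finset.prod_insert (by simp [ha])]
    ring

section familyStar

variable {ι κ : Type*} [Fintype ι] [Fintype κ] [DecidableEq ι] [DecidableEq κ]

theorem univ_option_val (ι : Type*) [Fintype ι] :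
    (Finset.univ : Finset (Option ι)).val = none ::ₘ Finset.univ.val.map some := rfl

omit [Fintype κ] [DecidableEq ι] in
theorem filter_option_map {β : Type*} (g : Option ι → Option κ) (i : κ) (u : Option ι → β) :
    (Finset.univ.filter fun o => g o = some i).val.map u =
      if g none = some i then
        u none ::ₘ (Finset.univ.filter fun j => g (some j) = some i).val.map fun j => u (some j)
      else (Finset.univ.filter fun j => g (some j) = some i).val.map fun j => u (some j) := by
  rw [Finset.filter_val, univ_option_val, Multiset.filter_cons, Multiset.filter_map,
    Multiset.map_add, Multiset.map_map]
  split_ifs <;> simp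

/-- Adding an element to the first factor of the product `∗`. -/
theorem familyStar_option (a : TreePreLie k α) (w : ι → TreePreLie k α)
    (v : κ → TreePreLie k α) :
    familyStar (fun o : Option ι => o.elim a w) v =
      toPoly k α a * familyStar w v + ∑ f : ι → Option κ, ∑ i,
        toPoly k α (brace (a ::ₘ (Finset.univ.filter fun j => f j = some i).val.map w) (v i)) *
        ((∏ j with f j = none, toPoly k α (w j)) *
          ∏ i' ∈ Finset.univ.erase i, toPoly k α
            (brace ((Finset.univ.filter fun j => f j = some i').val.map w) (v i'))) := by
  -- A map on `Option ι` is its value at `none` together with its restriction to `ι`. The value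
  -- `none` makes `a` a polynomial factor; the value `some i` puts `a` into the brace of `v i`.
  rw [familyStar_eq_sum, familyStar_eq_sum,
    Fintype.sum_equiv (Equiv.piOptionEquivProd (α := ι) (β := fun _ => Option κ)) _
      (fun p => (if p.1 = none then toPoly k α a else 1) *
        (∏ j with p.2 j = none, toPoly k α (w j)) *
        ∏ i, toPoly k α (brace (if p.1 = some i then
          a ::ₘ (Finset.univ.filter fun j => p.2 j = some i).val.map w
          else (Finset.univ.filter fun j => p.2 j = some i).val.map w) (v i))),
    Fintype.sum_prod_type_right, Finset.mul_sum, ← Finset.sum_add_distrib]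
  · refine Finset.sum_congr rfl fun f _ => ?_
    rw [Fintype.sum_option]
    congr 1
    · simp [mul_assoc]
    · refine Finset.sum_congr rfl fun i _ => ?_
      rw [← Finset.mul_prod_erase Finset.univ _ (Finset.mem_univ i)]
      simp only [reduceCtorEq, if_false, one_mul, if_true]
      rw [mul_left_comm]
      refine congrArg _ (congrArg _ (Finset.prod_congr rfl fun i' hi' => ?_))
      rw [if_neg]
      simpa using (Finset.ne_of_mem_erase hi').symm
  · intro g
    simp only [filter_option_map]
    congr 1
    rw [Finset.prod_filter, Fintype.prod_option, Finset.prod_filter]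
    rfl

/-- The combinatorial form of $(a \ast A) \ast B = a \ast (A \ast B)$. On the right the derivation
hits either an entry of $W_0$ or a factor $\{W_i\}v_i$; in the second case the brace recursion
writes $a \triangleright \{W_i\}v_i$ as the brace with $a$ added to $W_i$ plus the braces with one
entry $w_j$ of $W_i$ replaced by $a \triangleright w_j$. -/
theorem familyStar_option_eq (a : TreePreLie k α) (w : ι → TreePreLie k α)
    (v : κ → TreePreLie k α) :
    familyStar (fun o : Option ι => o.elim a w) v +
        ∑ j, familyStar (Function.update w j (a * w j)) v = leftMul a (familyStar w v) := by
  rw [familyStar_option, leftMul_apply, add_assoc, familyStar_eq_sum w v, map_sum]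
  simp only [familyStar_update]
  rw [Finset.sum_comm (s := (Finset.univ : Finset ι)), ← Finset.sum_add_distrib]
  refine congrArg _ (Finset.sum_congr rfl fun f _ => ?_)
  -- The replaced index `j` is sorted by `f j`: the fibre over `none` matches the derivative of
  -- $W_0$, and the fibre over `some i` the corrections in the brace recursion at `v i`.
  rw [← Finset.sum_fiberwise Finset.univ f, Fintype.sum_option, Derivation.leibniz,
    derivation_prod, derivation_prod, smul_eq_mul, smul_eq_mul]
  rw [add_left_comm, ← Finset.sum_add_distrib, add_comm]
  congr 1
  · rw [Finset.mul_sum]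
    refine Finset.sum_congr rfl fun i _ => ?_
    rw [brace_cons_map, graftDer_toPoly, ← mul_def, map_sub, sub_mul, map_sum, Finset.sum_mul,
      mul_left_comm, sub_add_eq_add_sub, add_sub_assoc, add_eq_left, sub_eq_zero]
    refine Finset.sum_congr rfl fun j hj => ?_
    rw [familyTerm_of_some _ _ _ _ i (by simpa using hj)]
  · rw [Finset.mul_sum]
    refine Finset.sum_congr rfl fun j hj => ?_
    rw [familyTerm_of_none _ _ _ _ (by simpa using hj), graftDer_toPoly, ← mul_def]
    ring

theorem familyStar_of_isEmpty [IsEmpty ι] (w : ι → TreePreLie k α) (v : κ → TreePreLie k α) :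
    familyStar w v = ∏ i, toPoly k α (v i) := by
  rw [familyStar_eq_sum]
  simp

end familyStar

theorem forest_eq_prod (F : Multiset (DecoratedTree α)) :
    forest k F = ∏ j : Fin F.toList.length, toPoly k α (treeBasis k α F.toList[j]) := by
  conv_lhs => rw [← map_univ_getElem F]
  rw [forest, Multiset.map_map]
  exact Finset.prod_congr rfl fun j _ => (toPoly_basis _).symm

theorem starHom_one (Q : MvPolynomial (DecoratedTree α) k) : starHom k α 1 Q = Q := by
  classical
  induction Q using poly_induction with
  | hadd p q hp hq => rw [map_add, hp, hq]
  | hsmul c p hp => rw [map_smul, hp]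
  | hf F =>
    have h : starHom k α 1 (forest k F) = forestStar k 0 F := by
      simpa [forest] using starHom_forest (k := k) 0 F
    have h2 := familyStar_eq_forestStar (k := k) (fun j : Fin 0 => j.elim0)
      (fun i : Fin F.toList.length => F.toList[i])
    rw [map_univ_getElem, familyStar_of_isEmpty] at h2
    rw [h, forest_eq_prod F]
    exact h2.symm

/-- By linearity $w$ is a tree and $A$, $B$ are forests, which reduces the claim to
`familyStar_option_eq`. -/
theorem starHom_leftMul (w : TreePreLie k α) (A B : MvPolynomial (DecoratedTree α) k) :
    starHom k α (leftMul w A) B = leftMul w (starHom k α A B) := by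
  classical
  induction w using basis_induction with
  | h0 => simp [leftMul_zero]
  | hadd x y hx hy => simp [leftMul_add, hx, hy]
  | hsmul c x hx => simp [leftMul_smul, hx]
  | hb t =>
    induction A using poly_induction with
    | hadd p q hp hq => simp [hp, hq]
    | hsmul c p hp => simp [hp]
    | hf A =>
      induction B using poly_induction with
      | hadd p q hp hq => simp [hp, hq]
      | hsmul c p hp => simp [hp]
      | hf B =>
        set τ := fun j : Fin A.toList.length => A.toList[j]
        set σ := fun i : Fin B.toList.length => B.toList[i]
        have hA : Finset.univ.val.map τ = A := map_univ_getElem A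
        have hB : Finset.univ.val.map σ = B := map_univ_getElem B
        rw [starHom_forest, ← hA, ← hB, ← familyStar_eq_forestStar, ← familyStar_option_eq, hA,
          hB, leftMul_apply, map_add, LinearMap.add_apply, toPoly_basis, ← forest_cons,
          starHom_forest]
        congr 1
        · have h := familyStar_eq_forestStar (k := k) (fun o : Option (Fin _) => o.elim t τ) σ
          have h1 : Finset.univ.val.map (fun o : Option (Fin _) => o.elim t τ) = t ::ₘ A := by
            conv_rhs => rw [← hA]
            rw [univ_option_val, Multiset.map_cons, Multiset.map_map]
            rfl
          rw [h1, hB] at h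
          rw [← h]
          congr 1
          funext o
          cases o <;> rfl
        · rw [forest_eq_prod, derivation_prod, map_sum, LinearMap.sum_apply]
          refine Finset.sum_congr rfl fun j _ => ?_
          rw [graftDer_toPoly]
          -- The replaced entry $t \triangleright \tau_j$ is not a tree, so
          -- `familyStar_eq_forestStar` does not apply directly; both sides are additive in this
          -- entry and agree when it is a tree.
          have key := addMonoidHom_graft_eq (k := k)
            (f := (((starHom k α).flip (forest k B) ∘ₗ LinearMap.mulRight k
              (∏ j' ∈ Finset.univ.erase j, toPoly k α (treeBasis k α (τ j'))) ∘ₗ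
                toPoly k α : _ →ₗ[k] _) : _ →+ _))
            (g := ∑ f : Fin A.toList.length → Option (Fin B.toList.length),
              familyTerm (treeBasis k α ∘ τ) (treeBasis k α ∘ σ) f j) (fun r => ?_) t (τ j)
          · rw [AddMonoidHom.finsetSum_apply, ← familyStar_update] at key
            exact key
          · rw [AddMonoidHom.finsetSum_apply, ← familyStar_update, ← Function.comp_update,
              familyStar_eq_forestStar, hB, ← starHom_forest, map_update_of_mem _ _
                (Finset.mem_univ j), forest_cons]
            have h : forest k ((Finset.univ.erase j).val.map τ) =
                ∏ j' ∈ Finset.univ.erase j, toPoly k α (treeBasis k α (τ j')) := by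
              rw [forest, Multiset.map_map]
              exact Finset.prod_congr rfl fun j _ => (toPoly_basis _).symm
            rw [h]
            simp

theorem starHom_toPoly (w : TreePreLie k α) (Q : MvPolynomial (DecoratedTree α) k) :
    starHom k α (toPoly k α w) Q = leftMul w Q := by
  rw [← leftMul_one, starHom_leftMul, starHom_one]

end TreePreLie

/-! ### Power series in operators that raise the degree -/

namespace Module.End

open Polynomial

variable {k : Type*} [CommRing k] {V W : ℕ → Type*} [∀ n, AddCommGroup (V n)]
  [∀ n, Module k (V n)] [∀ n, AddCommGroup (W n)] [∀ n, Module k (W n)]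

/-- The operator maps series without components of degree `< d` to series without components of
degree `≤ d`. -/
def IsRaising (M : Module.End k (∀ n, V n)) : Prop :=
  ∀ (d : ℕ) (F : ∀ n, V n), (∀ j < d, F j = 0) → ∀ j ≤ d, M F j = 0

/-- The value of a formal power series at an operator on a product, which is meaningful when the
operator is raising. -/
noncomputable def evalPowerSeries (φ : PowerSeries k) (M : Module.End k (∀ n, V n)) :
    Module.End k (∀ n, V n) :=
  LinearMap.pi fun d => LinearMap.proj d ∘ₗ aeval M (φ.trunc (d + 1))

theorem evalPowerSeries_apply (φ : PowerSeries k) (M : Module.End k (∀ n, V n)) (F : ∀ n, V n)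
    (d : ℕ) : evalPowerSeries φ M F d = aeval M (φ.trunc (d + 1)) F d := rfl

theorem evalPowerSeries_apply_eq_sum (φ : PowerSeries k) (M : Module.End k (∀ n, V n))
    (F : ∀ n, V n) (d : ℕ) :
    evalPowerSeries φ M F d =
      ∑ n ∈ Finset.range (d + 1), PowerSeries.coeff n φ • (M ^ n) F d := by
  rw [evalPowerSeries_apply, aeval_eq_sum_range' (PowerSeries.natDegree_trunc_lt φ d),
    LinearMap.sum_apply, Finset.sum_apply]
  refine Finset.sum_congr rfl fun n hn => ?_
  rw [PowerSeries.coeff_trunc, if_pos (Finset.mem_range.1 hn)]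
  rfl

theorem evalPowerSeries_sub (φ ψ : PowerSeries k) (M : Module.End k (∀ n, V n)) :
    evalPowerSeries (φ - ψ) M = evalPowerSeries φ M - evalPowerSeries ψ M := by
  refine LinearMap.ext fun F => funext fun d => ?_
  rw [evalPowerSeries_apply, PowerSeries.trunc_sub, map_sub]
  rfl

namespace IsRaising

variable {M : Module.End k (∀ n, V n)} (hM : IsRaising M)
include hM

theorem pow_apply_eq_zero (n : ℕ) {d : ℕ} {F : ∀ n, V n} (hF : ∀ j < d, F j = 0) {j : ℕ}
    (hj : j < d + n) : (M ^ n) F j = 0 := by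
  induction n generalizing d F with
  | zero => exact hF j hj
  | succ n ih =>
    rw [pow_succ, Module.End.mul_apply]
    exact ih (d := d + 1) (fun i hi => hM d F hF i (by omega)) (by omega)

theorem aeval_apply_eq_zero (p : k[X]) {d : ℕ} {F : ∀ n, V n} (hF : ∀ j < d, F j = 0) {j : ℕ}
    (hj : j < d) : aeval M p F j = 0 := by
  rw [aeval_eq_sum_range, LinearMap.sum_apply, Finset.sum_apply]
  refine Finset.sum_eq_zero fun n _ => ?_
  rw [LinearMap.smul_apply, Pi.smul_apply, hM.pow_apply_eq_zero n hF (by omega), smul_zero]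

/-- The difference of the polynomials is divisible by $X^{d+1}$, and $M^{d+1}$ maps everything to
order at least $d+1$. Hence the truncation used to define `evalPowerSeries` is immaterial once it is
long enough. -/
theorem aeval_apply_congr {p q : k[X]} {d : ℕ} (h : ∀ n ≤ d, p.coeff n = q.coeff n)
    (F : ∀ n, V n) : aeval M p F d = aeval M q F d := by
  rw [← sub_eq_zero, ← Pi.sub_apply, ← LinearMap.sub_apply, ← map_sub]
  have hd : Polynomial.X ^ (d + 1) ∣ p - q := by
    rw [Polynomial.X_pow_dvd_iff]
    intro n hn
    rw [coeff_sub, h n (by omega), sub_self]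
  obtain ⟨r, hr⟩ := hd
  rw [hr, map_mul, map_pow, aeval_X, Module.End.mul_apply]
  exact hM.pow_apply_eq_zero (d + 1) (d := 0) (by simp) (by omega)

theorem evalPowerSeries_apply_of_coeff_eq {φ : PowerSeries k} {p : k[X]} {d : ℕ}
    (h : ∀ n ≤ d, p.coeff n = PowerSeries.coeff n φ) (F : ∀ n, V n) :
    evalPowerSeries φ M F d = aeval M p F d := by
  rw [evalPowerSeries_apply]
  refine hM.aeval_apply_congr (fun n hn => ?_) F
  rw [PowerSeries.coeff_trunc, if_pos (by omega), h n hn]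

theorem evalPowerSeries_apply_of_le (φ : PowerSeries k) {d N : ℕ} (h : d ≤ N) (F : ∀ n, V n) :
    evalPowerSeries φ M F d = aeval M (φ.trunc (N + 1)) F d :=
  hM.evalPowerSeries_apply_of_coeff_eq
    (fun n hn => by rw [PowerSeries.coeff_trunc, if_pos (by omega)]) F

theorem evalPowerSeries_apply_congr {φ ψ : PowerSeries k} {d : ℕ}
    (h : ∀ n ≤ d, PowerSeries.coeff n φ = PowerSeries.coeff n ψ) (F : ∀ n, V n) :
    evalPowerSeries φ M F d = evalPowerSeries ψ M F d :=
  hM.evalPowerSeries_apply_of_coeff_eq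
    (fun n hn => by rw [PowerSeries.coeff_trunc, if_pos (by omega), h n hn]) F

/-- In degree $d$ the product of the two truncations may be evaluated instead. The inner truncated
value differs from the true one only in degrees $> d$, and a polynomial in $M$ does not lower the
order of this difference. -/
theorem evalPowerSeries_mul (φ ψ : PowerSeries k) :
    evalPowerSeries (φ * ψ) M = evalPowerSeries φ M * evalPowerSeries ψ M := by
  refine LinearMap.ext fun F => funext fun d => ?_
  rw [Module.End.mul_apply, evalPowerSeries_apply φ, hM.evalPowerSeries_apply_of_coeff_eq
    (p := φ.trunc (d + 1) * ψ.trunc (d + 1)), map_mul, Module.End.mul_apply, ← sub_eq_zero,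
    ← Pi.sub_apply, ← map_sub]
  · refine hM.aeval_apply_eq_zero _ (d := d + 1) (fun j hj => ?_) (by omega)
    rw [Pi.sub_apply, hM.evalPowerSeries_apply_of_le ψ (Nat.lt_succ_iff.1 hj), sub_self]
  · intro n hn
    rw [Polynomial.coeff_mul, PowerSeries.coeff_mul]
    refine Finset.sum_congr rfl fun p hp => ?_
    have := Finset.HasAntidiagonal.mem_antidiagonal.1 hp
    rw [PowerSeries.coeff_trunc, PowerSeries.coeff_trunc, if_pos (by omega), if_pos (by omega)]

theorem evalPowerSeries_coe (p : k[X]) : evalPowerSeries (p : PowerSeries k) M = aeval M p :=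
  LinearMap.ext fun F => funext fun _ =>
    hM.evalPowerSeries_apply_of_coeff_eq (fun _ _ => (Polynomial.coeff_coe _ _).symm) F

theorem evalPowerSeries_one : evalPowerSeries (1 : PowerSeries k) M = 1 := by
  rw [← Polynomial.coe_one, hM.evalPowerSeries_coe, map_one]

theorem evalPowerSeries_X : evalPowerSeries (PowerSeries.X : PowerSeries k) M = M := by
  rw [← Polynomial.coe_X, hM.evalPowerSeries_coe, aeval_X]

/-- Maps which intertwine two operators and respect the filtrations intertwine the values of a
power series at the operators. -/
theorem map_evalPowerSeries {L : Module.End k (∀ n, W n)}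
    (B : (∀ n, V n) →ₗ[k] ∀ n, W n) (hB : ∀ F, B (M F) = L (B F))
    (hB' : ∀ (d : ℕ) (F : ∀ n, V n), (∀ j ≤ d, F j = 0) → B F d = 0) (φ : PowerSeries k)
    (F : ∀ n, V n) : B (evalPowerSeries φ M F) = evalPowerSeries φ L (B F) := by
  have h : ∀ (p : k[X]), B (aeval M p F) = aeval L p (B F) := by
    intro p
    have hpow : ∀ n : ℕ, B ((M ^ n) F) = (L ^ n) (B F) := by
      intro n
      induction n with
      | zero => rfl
      | succ n ih => rw [pow_succ', pow_succ', Module.End.mul_apply, Module.End.mul_apply, hB, ih]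
    rw [aeval_eq_sum_range, aeval_eq_sum_range, LinearMap.sum_apply, LinearMap.sum_apply, map_sum]
    refine Finset.sum_congr rfl fun n _ => ?_
    rw [LinearMap.smul_apply, LinearMap.smul_apply, map_smul, hpow]
  funext d
  -- The polynomial truncated for degree $d$ is correct in all degrees $\le d$, which is all that
  -- degree $d$ of `B` depends on.
  rw [evalPowerSeries_apply, ← h, ← sub_eq_zero, ← Pi.sub_apply, ← map_sub]
  refine hB' d _ fun j hj => ?_
  rw [Pi.sub_apply, hM.evalPowerSeries_apply_of_le φ hj, sub_self]

/-- Since $\psi^n$ has order at least $n$, only the powers with $n \le d$ affect the coefficients up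
to $d$. -/
theorem evalPowerSeries_subst {φ ψ : PowerSeries k} (hψ : PowerSeries.constantCoeff ψ = 0)
    (F : ∀ n, V n) (d : ℕ) :
    evalPowerSeries (φ.subst ψ) M F d =
      ∑ n ∈ Finset.range (d + 1), PowerSeries.coeff n φ • evalPowerSeries (ψ ^ n) M F d := by
  rw [hM.evalPowerSeries_apply_congr
    (ψ := ∑ n ∈ Finset.range (d + 1), PowerSeries.coeff n φ • ψ ^ n), evalPowerSeries_apply]
  · have h : PowerSeries.trunc (d + 1)
        (∑ n ∈ Finset.range (d + 1), PowerSeries.coeff n φ • ψ ^ n) =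
        ∑ n ∈ Finset.range (d + 1), PowerSeries.coeff n φ • PowerSeries.trunc (d + 1) (ψ ^ n) := by
      ext m
      simp [PowerSeries.coeff_trunc]
    rw [h, map_sum, LinearMap.sum_apply, Finset.sum_apply]
    refine Finset.sum_congr rfl fun n _ => ?_
    rw [map_smul]
    rfl
  · intro n hn
    rw [PowerSeries.coeff_subst' (PowerSeries.HasSubst.of_constantCoeff_zero' hψ), map_sum,
      finsum_eq_sum_of_support_subset _ (s := Finset.range (d + 1))]
    · rfl
    · intro m hm
      by_contra hmd
      refine hm ?_
      simp only [Finset.coe_range, Set.mem_Iio, not_lt] at hmd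
      have : PowerSeries.coeff n (ψ ^ m) = 0 := by
        refine PowerSeries.coeff_of_lt_order _ (lt_of_lt_of_le ?_
          (PowerSeries.le_order_pow_of_constantCoeff_eq_zero m hψ))
        exact_mod_cast (by omega : n < m)
      simp [this]

end IsRaising

end Module.End

/-! ### Formal logarithm and exponential, and a fixed point principle -/

/-- The composition of the logarithm with the exponential. -/
theorem PowerSeries.log_subst_exp_sub_one (k : Type*) [Field k] [CharZero k] :
    (PowerSeries.log k).subst (PowerSeries.exp k - 1) = (PowerSeries.X : PowerSeries k) := by
  have hs : HasSubst (exp k - 1) := HasSubst.exp_sub_one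
  have hd : derivative k (log k) * (1 + X) = 1 := by
    rw [deriv_log, mul_add, mul_one]
    ext n
    cases n with
    | zero => simp
    | succ n => simp [coeff_succ_mul_X, coeff_one, pow_succ]
  -- Both sides have constant term $0$ and derivative $1$: substituting $e^X - 1$ into `hd` shows
  -- that $\log'$ becomes the inverse of $e^X$, which the chain rule cancels.
  refine derivative.ext ?_ ?_
  · have h := congrArg (PowerSeries.subst (exp k - 1)) hd
    have h1 : PowerSeries.subst (exp k - 1) (1 : PowerSeries k) = 1 := by
      rw [← coe_substAlgHom hs, map_one]
    rw [subst_mul hs, subst_add hs, subst_X hs, h1, add_sub_cancel] at h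
    rw [derivative_subst hs, map_sub, derivative_exp, derivative_one, sub_zero, h, derivative_X]
  · rw [constantCoeff_X]
    have h0 : constantCoeff (exp k - 1) = 0 := by simp
    exact constantCoeff_subst_eq_zero h0 _ constantCoeff_log

/-- A map on a product whose components of degree `d` only depend on components of lower degree
has exactly one fixed point. -/
theorem exists_unique_fixedPoint {V : ℕ → Type*} [∀ n, Inhabited (V n)]
    (Ψ : (∀ n, V n) → ∀ n, V n)
    (h : ∀ (d : ℕ) (F G : ∀ n, V n), (∀ j < d, F j = G j) → Ψ F d = Ψ G d) :
    ∃! F, Ψ F = F := by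
  have key : ∀ (d : ℕ) (F G : ∀ n, V n), (∀ j < d, F j = G j) → ∀ j < d + 1, Ψ F j = Ψ G j :=
    fun d F G hFG j hj => h j F G fun i hi => hFG i (by omega)
  have hit : ∀ (d : ℕ) (F G : ∀ n, V n), ∀ j < d, Ψ^[d] F j = Ψ^[d] G j := by
    intro d
    induction d with
    | zero => intro F G j hj; omega
    | succ d ih =>
      intro F G j hj
      rw [Function.iterate_succ_apply', Function.iterate_succ_apply']
      exact key d _ _ (ih F G) j hj
  have hst : ∀ (d n : ℕ) (F : ∀ n, V n), ∀ j < d, Ψ^[d + n] F j = Ψ^[d] F j := by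
    intro d n F j hj
    rw [Function.iterate_add_apply]
    exact hit d _ _ j hj
  -- The component of degree $d$ is stationary from the iterate $d+1$ on, and by `hit` it does not
  -- depend on the starting point.
  let F : ∀ n, V n := fun d => Ψ^[d + 1] default d
  have hF : ∀ d, ∀ j < d, F j = Ψ^[d] default j := by
    intro d j hj
    obtain ⟨n, rfl⟩ := Nat.exists_eq_add_of_le (Nat.succ_le_of_lt hj)
    exact (hst (j + 1) n default j (by omega)).symm
  refine ⟨F, ?_, ?_⟩
  · funext d
    rw [h d F _ (hF d), ← Function.iterate_succ_apply' Ψ]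
  · intro G hG
    funext d
    induction d using Nat.strong_induction_on with
    | h d ih =>
      rw [← hG, h d G _ fun j hj => (ih j hj).trans (hF d j hj),
        ← Function.iterate_succ_apply' Ψ]

/-! ### The differential equation for the exponential -/

namespace PowerSeries

section MapCoeff

variable {k A : Type*} [CommRing k] [CommRing A] [Algebra k A]

/-- The derivation of the algebra of formal power series which applies a derivation to the
coefficients. -/
noncomputable def coeffDerivation (D : Derivation k A A) : Derivation k A⟦X⟧ A⟦X⟧ :=
  Derivation.mk'
    { toFun := fun f => mk fun n => D (coeff n f)
      map_add' := fun f g => by ext n; simp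
      map_smul' := fun c f => by ext n; simp } fun f g => by
    ext n
    simp only [LinearMap.coe_mk, AddHom.coe_mk, coeff_mk, coeff_mul, map_sum, map_add, smul_eq_mul,
      Derivation.leibniz, Finset.sum_add_distrib]
    refine congrArg _ ?_
    rw [← Finset.Nat.sum_antidiagonal_swap]
    rfl

@[simp] theorem coeff_coeffDerivation (D : Derivation k A A) (f : A⟦X⟧) (n : ℕ) :
    coeff n (coeffDerivation D f) = D (coeff n f) :=
  coeff_mk n fun n => D (coeff n f)

end MapCoeff

section ExpDerivation

open Nat

theorem coeff_pow_eq_zero {A : Type*} [CommRing A] {f : A⟦X⟧} (hf : constantCoeff f = 0)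
    {n m : ℕ} (h : n < m) : coeff n (f ^ m) = 0 :=
  coeff_of_lt_order _ (lt_of_lt_of_le (by exact_mod_cast h)
    (le_order_pow_of_constantCoeff_eq_zero m hf))

variable {k A : Type*} [Field k] [CommRing A] [Algebra k A]

/-- The partial sum of the exponential series. -/
noncomputable def expPartial (k : Type*) [Field k] [Algebra k A] (f : A⟦X⟧) (N : ℕ) : A⟦X⟧ :=
  ∑ m ∈ Finset.range (N + 1), (m ! : k)⁻¹ • f ^ m

/-- The chain rule for the exponential; the constant term is killed and the factorials shift, so the
partial sum gets shorter by one term. -/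
theorem derivation_expPartial [CharZero k] (D : Derivation k A⟦X⟧ A⟦X⟧) (f : A⟦X⟧) (N : ℕ) :
    D (expPartial k f (N + 1)) = expPartial k f N * D f := by
  rw [expPartial, expPartial, Finset.sum_range_succ', map_add, map_sum, Finset.sum_mul]
  simp only [pow_zero, Derivation.map_smul, Derivation.map_one_eq_zero, smul_zero, add_zero]
  refine Finset.sum_congr rfl fun m _ => ?_
  have h : (m + 1 : k) ≠ 0 := by exact_mod_cast Nat.succ_ne_zero m
  rw [Derivation.leibniz_pow, Nat.add_sub_cancel, smul_eq_mul, ← Nat.cast_smul_eq_nsmul k,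
    smul_smul, smul_mul_assoc, Nat.factorial_succ]
  congr 1
  push_cast
  field_simp

theorem coeff_expPartial_congr {f : A⟦X⟧} (hf : constantCoeff f = 0) {n N N' : ℕ} (h : n ≤ N)
    (h' : n ≤ N') : coeff n (expPartial k f N) = coeff n (expPartial k f N') := by
  have key : ∀ N, n ≤ N → coeff n (expPartial k f N) = coeff n (expPartial k f n) := by
    intro N hN
    induction N, hN using Nat.le_induction with
    | base => rfl
    | succ N hN ih =>
      rw [← ih, expPartial, Finset.sum_range_succ, map_add, coeff_smul,
        coeff_pow_eq_zero hf (Nat.lt_succ_of_le hN), smul_zero, add_zero]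
      rfl
  rw [key N h, key N' h']

/-- The series `∑ₙ Dⁿ w Xⁿ⁺¹ / (n + 1)!`, the solution of `y' = w + D y` which vanishes at `0`. -/
noncomputable def derivationSeries (D : Derivation k A A) (w : A) : A⟦X⟧ :=
  X * mk fun n => ((n + 1)! : k)⁻¹ • D^[n] w

theorem constantCoeff_derivationSeries (D : Derivation k A A) (w : A) :
    constantCoeff (derivationSeries D w) = 0 := by
  simp [derivationSeries]

theorem coeff_succ_derivationSeries (D : Derivation k A A) (w : A) (n : ℕ) :
    coeff (n + 1) (derivationSeries D w) = ((n + 1)! : k)⁻¹ • D^[n] w := by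
  rw [derivationSeries, coeff_succ_X_mul, coeff_mk]

/-- $(n+1)$ times each coefficient of index $n+1$ is $D$ of the preceding one, so everything cancels
except the initial term `w`. -/
theorem derivative_sub_coeffDerivation_derivationSeries [CharZero k] (D : Derivation k A A) (w : A) :
    ((derivative A).restrictScalars k - coeffDerivation D) (derivationSeries D w) = C w := by
  ext n
  rw [Derivation.sub_apply, Derivation.restrictScalars_apply, map_sub, coeff_derivative,
    coeff_coeffDerivation, coeff_succ_derivationSeries]
  cases n with
  | zero => simp [constantCoeff_derivationSeries]
  | succ n =>
    have h : ((n + 1 : ℕ) + 1 : k) ≠ 0 := by exact_mod_cast Nat.succ_ne_zero (n + 1)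
    have h' : ((n + 1 : ℕ) + 1 : A) = algebraMap k A ((n + 1 : ℕ) + 1) := by simp
    rw [coeff_succ_derivationSeries, D.map_smul, ← Function.iterate_succ_apply' D, h', mul_comm,
      ← Algebra.smul_def, smul_smul, coeff_C, if_neg (Nat.succ_ne_zero n), sub_eq_zero,
      Nat.factorial_succ (n + 1)]
    congr 1
    push_cast at h ⊢
    field_simp

/-- The coefficients of the exponential of `∑ₙ Dⁿ w Xⁿ⁺¹ / (n + 1)!` are the `Mⁿ 1 / n!`, where
`M` is the operator `f ↦ w f + D f`. -/
theorem coeff_expPartial_derivationSeries [CharZero k] (D : Derivation k A A) (w : A) {n N : ℕ} (h : n ≤ N) :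
    coeff n (expPartial k (derivationSeries D w) N) =
      (n ! : k)⁻¹ • ((LinearMap.mulLeft k w + (D : A →ₗ[k] A) : Module.End k A) ^ n) 1 := by
  have h0 := constantCoeff_derivationSeries D w
  induction n generalizing N with
  | zero => rw [coeff_expPartial_congr h0 h (le_refl 0)]; simp [expPartial]
  | succ n ih =>
    obtain ⟨N, rfl⟩ : ∃ N', N = N' + 1 := ⟨N - 1, by omega⟩
    -- Applying the derivation $\partial - D$ to $E = \exp y$ gives $wE$. Its coefficient of index
    -- $n$ reads $(n+1)E_{n+1} = wE_n + DE_n$, the recursion satisfied by $M^n 1/n!$.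
    have h1 := congrArg (coeff n) (derivation_expPartial
      ((derivative A).restrictScalars k - coeffDerivation D) (derivationSeries D w) N)
    rw [derivative_sub_coeffDerivation_derivationSeries, Derivation.sub_apply,
      Derivation.restrictScalars_apply, map_sub, coeff_derivative, coeff_coeffDerivation,
      coeff_mul_C, ih (by omega), ih (by omega), sub_eq_iff_eq_add] at h1
    have hk : (n + 1 : k) ≠ 0 := by exact_mod_cast Nat.succ_ne_zero n
    have hA : (n + 1 : A) = algebraMap k A (n + 1) := by simp
    rw [hA, mul_comm, ← Algebra.smul_def] at h1
    rw [_root_.pow_succ', Module.End.mul_apply, LinearMap.add_apply, LinearMap.mulLeft_apply,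
      Nat.factorial_succ, Nat.cast_mul, mul_inv, mul_smul, smul_add, eq_inv_smul_iff₀]
    · push_cast
      rw [h1, D.map_smul, smul_mul_assoc, mul_comm w]
    · exact_mod_cast hk

end ExpDerivation

/-! ### Setting the outer variable equal to $1$ -/

section Diagonal

variable {R : Type*} [CommRing R]

/-- The coefficients of index `n` are divisible by `Xⁿ`, up to degree `N`. -/
def IsDiagonal (N : ℕ) (a : R⟦X⟧⟦X⟧) : Prop :=
  ∀ n i, i < n → i ≤ N → coeff i (coeff n a) = 0

/-- The sum of the coefficients. -/
noncomputable def coeffSum (a : R⟦X⟧⟦X⟧) : R⟦X⟧ :=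
  mk fun d => ∑ n ∈ Finset.range (d + 1), coeff d (coeff n a)

theorem IsDiagonal.one (N : ℕ) : IsDiagonal N (1 : R⟦X⟧⟦X⟧) := by
  intro n i h _
  rw [coeff_one, if_neg (by omega), map_zero]

theorem IsDiagonal.coeff_mul_eq_zero {N : ℕ} {a b : R⟦X⟧⟦X⟧} (ha : IsDiagonal N a)
    (hb : IsDiagonal N b) {n m d : ℕ} (h : d < n + m) (hd : d ≤ N) :
    coeff d (coeff n a * coeff m b) = 0 := by
  rw [coeff_mul]
  refine Finset.sum_eq_zero fun p hp => ?_
  have hp' := Finset.HasAntidiagonal.mem_antidiagonal.1 hp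
  by_cases h' : p.1 < n
  · rw [ha n p.1 h' (by omega), zero_mul]
  · rw [hb m p.2 (by omega) (by omega), mul_zero]

theorem IsDiagonal.mul {N : ℕ} {a b : R⟦X⟧⟦X⟧} (ha : IsDiagonal N a) (hb : IsDiagonal N b) :
    IsDiagonal N (a * b) := by
  intro n i h hi
  rw [coeff_mul, map_sum]
  refine Finset.sum_eq_zero fun p hp => ?_
  have hp' := Finset.HasAntidiagonal.mem_antidiagonal.1 hp
  exact ha.coeff_mul_eq_zero hb (by omega) hi

theorem IsDiagonal.pow {N : ℕ} {a : R⟦X⟧⟦X⟧} (ha : IsDiagonal N a) (m : ℕ) :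
    IsDiagonal N (a ^ m) := by
  induction m with
  | zero => rw [pow_zero]; exact .one N
  | succ m ih => rw [pow_succ]; exact ih.mul ha

theorem IsDiagonal.coeff_coeffSum {N : ℕ} {a : R⟦X⟧⟦X⟧} (ha : IsDiagonal N a) {d e : ℕ}
    (hd : d ≤ e) (he : e ≤ N) :
    coeff d (coeffSum a) = ∑ n ∈ Finset.range (e + 1), coeff d (coeff n a) := by
  rw [coeffSum, coeff_mk]
  refine Finset.sum_subset (Finset.range_subset_range.2 (by omega)) fun n _ hn => ?_
  exact ha n d (by simpa using hn) (by omega)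

/-- Evaluation of the outer variable at $1$ is multiplicative. Diagonality makes it a finite sum in
each inner degree; the bound `N` is kept because the series it serves are built from a truncation of
$\Omega$. -/
theorem IsDiagonal.coeff_coeffSum_mul {N : ℕ} {a b : R⟦X⟧⟦X⟧} (ha : IsDiagonal N a)
    (hb : IsDiagonal N b) {d : ℕ} (hd : d ≤ N) :
    coeff d (coeffSum (a * b)) = coeff d (coeffSum a * coeffSum b) := by
  have h1 : coeff d (coeffSum a * coeffSum b) =
      ∑ x ∈ Finset.range (d + 1) ×ˢ Finset.range (d + 1),
        coeff d (coeff x.1 a * coeff x.2 b) := by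
    simp only [coeff_mul]
    rw [Finset.sum_comm]
    refine Finset.sum_congr rfl fun p hp => ?_
    have hp' := Finset.HasAntidiagonal.mem_antidiagonal.1 hp
    rw [ha.coeff_coeffSum (e := d) (by omega) hd, hb.coeff_coeffSum (e := d) (by omega) hd,
      Finset.sum_mul_sum, Finset.sum_product]
  have h2 : coeff d (coeffSum (a * b)) = ∑ n ∈ Finset.range (d + 1),
      ∑ x ∈ Finset.HasAntidiagonal.antidiagonal n, coeff d (coeff x.1 a * coeff x.2 b) := by
    rw [coeffSum, coeff_mk]
    refine Finset.sum_congr rfl fun n _ => ?_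
    rw [coeff_mul, map_sum]
  -- The product of sums runs over a square of indices, the sum of the product over a triangle; the
  -- indices of the square outside the triangle have sum $> d$ and contribute nothing.
  rw [h1, h2, ← Finset.sum_filter_of_ne (p := fun x : ℕ × ℕ => x.1 + x.2 ∈ Finset.range (d + 1)),
    ← Finset.sum_fiberwise_of_maps_to (t := Finset.range (d + 1)) (g := fun x : ℕ × ℕ => x.1 + x.2)]
  · refine Finset.sum_congr rfl fun n hn => Finset.sum_congr ?_ fun _ _ => rfl
    ext x
    simp only [Finset.mem_range] at hn
    simp only [Finset.HasAntidiagonal.mem_antidiagonal, Finset.mem_filter, Finset.mem_product, Finset.mem_range]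
    omega
  · intro x hx
    exact (Finset.mem_filter.1 hx).2
  · intro x _ hx
    by_contra h
    rw [Finset.mem_range, not_lt] at h
    exact hx (ha.coeff_mul_eq_zero hb (by omega) hd)

theorem IsDiagonal.coeff_coeffSum_pow {N : ℕ} {a : R⟦X⟧⟦X⟧} (ha : IsDiagonal N a) (m : ℕ) {d : ℕ}
    (hd : d ≤ N) : coeff d (coeffSum (a ^ m)) = coeff d (coeffSum a ^ m) := by
  induction m generalizing d with
  | zero =>
    rw [pow_zero, pow_zero, coeffSum, coeff_mk, Finset.sum_range_succ']
    simp [coeff_one]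
  | succ m ih =>
    rw [pow_succ, (ha.pow m).coeff_coeffSum_mul ha hd, pow_succ, coeff_mul, coeff_mul]
    refine Finset.sum_congr rfl fun p hp => ?_
    have hp' := Finset.HasAntidiagonal.mem_antidiagonal.1 hp
    rw [ih (by omega)]

end Diagonal

end PowerSeries

theorem Finset.sum_antidiagonal_assoc {M : Type*} [AddCommMonoid M] (n : ℕ) (f : ℕ → ℕ → ℕ → M) :
    ∑ p ∈ HasAntidiagonal.antidiagonal n, ∑ q ∈ HasAntidiagonal.antidiagonal p.1, f q.1 q.2 p.2 =
      ∑ p ∈ HasAntidiagonal.antidiagonal n,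
        ∑ q ∈ HasAntidiagonal.antidiagonal p.2, f p.1 q.1 q.2 := by
  simp only [Finset.sum_sigma']
  refine Finset.sum_nbij' (fun x => ⟨(x.2.1, x.2.2 + x.1.2), (x.2.2, x.1.2)⟩)
    (fun x => ⟨(x.1.1 + x.2.1, x.2.2), (x.1.1, x.2.1)⟩) ?_ ?_ ?_ ?_
    fun _ _ => rfl
  all_goals
    rintro ⟨⟨a, b⟩, ⟨c, d⟩⟩ h
    simp only [Finset.mem_sigma, HasAntidiagonal.mem_antidiagonal] at h ⊢
    obtain ⟨rfl, rfl⟩ := h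
    simp [add_assoc]

/-! ### The operators $\Omega \ast \cdot$ and $\Omega \triangleright \cdot$ on the completions -/

namespace TreePreLie

open DecoratedTree LeftPreLieRing Module.End

variable {k : Type*} [Field k] {α : Type*}

theorem gradedPiece_zero : gradedPiece k α 0 = ⊥ := by
  rw [gradedPiece, Submodule.span_eq_bot]
  rintro _ ⟨t, ht, rfl⟩
  exact absurd ht (numVertices_pos t).ne'

theorem Completion.apply_zero (x : Completion k α) : x 0 = 0 :=
  Subtype.ext ((Submodule.mem_bot k).1 (gradedPiece_zero (k := k) (α := α) ▸ (x 0).2))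

theorem braceHom_toPoly (w v : TreePreLie k α) : braceHom k α (toPoly k α w) v = w * v := by
  rw [← leftMul_one, braceHom_leftMul, braceHom_one]

namespace PolyCompletion

theorem coe_star (P Q : PolyCompletion k α) (n : ℕ) :
    (star P Q n : MvPolynomial (DecoratedTree α) k) =
      ∑ p ∈ Finset.HasAntidiagonal.antidiagonal n, starHom k α (P p.1) (Q p.2) := rfl

theorem coe_circ (P Q : PolyCompletion k α) (n : ℕ) :
    (circ P Q n : MvPolynomial (DecoratedTree α) k) =
      ∑ p ∈ Finset.HasAntidiagonal.antidiagonal n,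
        (P p.1 : MvPolynomial (DecoratedTree α) k) * (Q p.2 : MvPolynomial (DecoratedTree α) k) :=
  rfl

theorem coe_unit (n : ℕ) :
    (unit k α n : MvPolynomial (DecoratedTree α) k) = if n = 0 then 1 else 0 := by
  rw [unit]
  rcases eq_or_ne n 0 with rfl | h
  · simp
  · rw [Pi.single_eq_of_ne h, if_neg h]
    rfl

theorem sum_antidiagonal_unit_left {M : Type*} [AddCommMonoid M] (n : ℕ)
    (f : MvPolynomial (DecoratedTree α) k → ℕ → M) (hf : ∀ j, f 0 j = 0) :
    ∑ p ∈ Finset.HasAntidiagonal.antidiagonal n, f (unit k α p.1) p.2 = f 1 n := by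
  rw [Finset.sum_eq_single (0, n)]
  · rw [coe_unit, if_pos rfl]
  · rintro ⟨a, b⟩ hp hne
    rw [coe_unit, if_neg, hf]
    rintro rfl
    exact hne (by simpa using hp)
  · simp

theorem sum_antidiagonal_unit_right {M : Type*} [AddCommMonoid M] (n : ℕ)
    (f : ℕ → MvPolynomial (DecoratedTree α) k → M) (hf : ∀ j, f j 0 = 0) :
    ∑ p ∈ Finset.HasAntidiagonal.antidiagonal n, f p.1 (unit k α p.2) = f n 1 := by
  rw [← Finset.Nat.sum_antidiagonal_swap]
  exact sum_antidiagonal_unit_left n (fun P j => f j P) hf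

/-- The product `∗` with a fixed right factor. -/
noncomputable def starRight (Q : PolyCompletion k α) : Module.End k (PolyCompletion k α) where
  toFun P := star P Q
  map_add' P P' := funext fun n => Subtype.ext <| by
    simp [coe_star, Finset.sum_add_distrib]
  map_smul' c P := funext fun n => Subtype.ext <| by
    simp [coe_star, Finset.smul_sum]

end PolyCompletion

namespace Completion

/-- Left multiplication by an element of the completion of `V` for the product `∗`. -/
noncomputable def starLeft (Ω : Completion k α) : Module.End k (PolyCompletion k α) where
  toFun Q := PolyCompletion.star Ω.toPoly Q
  map_add' P P' := funext fun n => Subtype.ext <| by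
    simp [PolyCompletion.coe_star, Finset.sum_add_distrib]
  map_smul' c P := funext fun n => Subtype.ext <| by
    simp [PolyCompletion.coe_star, Finset.smul_sum]

theorem coe_starLeft (Ω : Completion k α) (Q : PolyCompletion k α) (n : ℕ) :
    (Ω.starLeft Q n : MvPolynomial (DecoratedTree α) k) =
      ∑ p ∈ Finset.HasAntidiagonal.antidiagonal n, leftMul (Ω p.1 : TreePreLie k α) (Q p.2) := by
  change ∑ p ∈ Finset.HasAntidiagonal.antidiagonal n, starHom k α (Ω.toPoly p.1) (Q p.2) = _
  exact Finset.sum_congr rfl fun p _ => starHom_toPoly (Ω p.1 : TreePreLie k α) _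

theorem coe_brace (P : PolyCompletion k α) (x : Completion k α) (n : ℕ) :
    (brace P x n : TreePreLie k α) =
      ∑ p ∈ Finset.HasAntidiagonal.antidiagonal n, braceHom k α (P p.1) (x p.2) := rfl

/-- The pre-Lie product with a fixed left factor. -/
noncomputable def preLieLeft (Ω : Completion k α) : Module.End k (Completion k α) where
  toFun x := brace Ω.toPoly x
  map_add' P P' := funext fun n => Subtype.ext <| by
    simp [coe_brace, Finset.sum_add_distrib]
  map_smul' c P := funext fun n => Subtype.ext <| by
    simp [coe_brace, Finset.smul_sum]

theorem coe_preLieLeft (Ω x : Completion k α) (n : ℕ) :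
    (Ω.preLieLeft x n : TreePreLie k α) =
      ∑ p ∈ Finset.HasAntidiagonal.antidiagonal n,
        (Ω p.1 : TreePreLie k α) * (x p.2 : TreePreLie k α) := by
  change ∑ p ∈ Finset.HasAntidiagonal.antidiagonal n, braceHom k α (Ω.toPoly p.1) (x p.2) = _
  exact Finset.sum_congr rfl fun p _ => braceHom_toPoly (Ω p.1 : TreePreLie k α) _

/-- The brace with a fixed right factor. -/
noncomputable def braceRight (x : Completion k α) : PolyCompletion k α →ₗ[k] Completion k α where
  toFun P := brace P x
  map_add' P P' := funext fun n => Subtype.ext <| by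
    simp [coe_brace, Finset.sum_add_distrib]
  map_smul' c P := funext fun n => Subtype.ext <| by
    simp [coe_brace, Finset.smul_sum]

theorem isRaising_starLeft (Ω : Completion k α) : IsRaising Ω.starLeft := by
  intro d F hF j hj
  refine Subtype.ext ?_
  rw [coe_starLeft]
  refine Finset.sum_eq_zero fun p hp => ?_
  have hp' := Finset.HasAntidiagonal.mem_antidiagonal.1 hp
  by_cases h0 : p.1 = 0
  · rw [h0, Ω.apply_zero, Submodule.coe_zero, leftMul_zero, LinearMap.zero_apply]
  · rw [hF p.2 (by omega), Submodule.coe_zero, map_zero]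

theorem isRaising_preLieLeft (Ω : Completion k α) : IsRaising Ω.preLieLeft := by
  intro d F hF j hj
  refine Subtype.ext ?_
  rw [coe_preLieLeft]
  refine Finset.sum_eq_zero fun p hp => ?_
  have hp' := Finset.HasAntidiagonal.mem_antidiagonal.1 hp
  by_cases h0 : p.1 = 0
  · rw [h0, Ω.apply_zero, Submodule.coe_zero, zero_mul]
  · rw [hF p.2 (by omega), Submodule.coe_zero, mul_zero]

theorem star_starLeft (Ω : Completion k α) (P Q : PolyCompletion k α) :
    PolyCompletion.star (Ω.starLeft P) Q = Ω.starLeft (PolyCompletion.star P Q) := by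
  refine funext fun n => Subtype.ext ?_
  rw [PolyCompletion.coe_star, coe_starLeft]
  simp only [coe_starLeft, PolyCompletion.coe_star, map_sum, LinearMap.sum_apply, starHom_leftMul]
  exact Finset.sum_antidiagonal_assoc n fun a b c =>
    leftMul (Ω a : TreePreLie k α) (starHom k α (P b) (Q c))

theorem brace_starLeft (Ω x : Completion k α) (P : PolyCompletion k α) :
    brace (Ω.starLeft P) x = Ω.preLieLeft (brace P x) := by
  refine funext fun n => Subtype.ext ?_
  rw [coe_brace, coe_preLieLeft]
  simp only [coe_starLeft, coe_brace, map_sum, LinearMap.sum_apply, braceHom_leftMul,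
    Finset.mul_sum]
  exact Finset.sum_antidiagonal_assoc n fun a b c =>
    (Ω a : TreePreLie k α) * braceHom k α (P b) (x c)

theorem brace_unit (x : Completion k α) : brace (PolyCompletion.unit k α) x = x := by
  refine funext fun n => Subtype.ext ?_
  rw [coe_brace, PolyCompletion.sum_antidiagonal_unit_left n
    (fun P j => braceHom k α P (x j)) (by simp), braceHom_one]

theorem _root_.TreePreLie.PolyCompletion.unit_star (P : PolyCompletion k α) :
    PolyCompletion.star (PolyCompletion.unit k α) P = P := by
  refine funext fun n => Subtype.ext ?_
  rw [PolyCompletion.coe_star, PolyCompletion.sum_antidiagonal_unit_left n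
    (fun Q j => starHom k α Q (P j)) (by simp), starHom_one]

theorem starLeft_unit (Ω : Completion k α) : Ω.starLeft (PolyCompletion.unit k α) = Ω.toPoly := by
  refine funext fun n => Subtype.ext ?_
  rw [coe_starLeft, PolyCompletion.sum_antidiagonal_unit_right n
    (fun j P => leftMul (Ω j : TreePreLie k α) P) (by simp), leftMul_one]
  rfl

/-- Right multiplication by `Q` commutes with left multiplication by `Ω`, hence with every series in
it. This replaces general associativity of $\ast$ when powers of a series in $\Omega$ are computed.
-/
theorem star_evalPowerSeries (φ : PowerSeries k) (Ω : Completion k α) (P Q : PolyCompletion k α) :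
    PolyCompletion.star (evalPowerSeries φ Ω.starLeft P) Q =
      evalPowerSeries φ Ω.starLeft (PolyCompletion.star P Q) := by
  refine Ω.isRaising_starLeft.map_evalPowerSeries (PolyCompletion.starRight Q)
    (fun P => Ω.star_starLeft P Q) (fun d F hF => Subtype.ext ?_) φ P
  change ∑ p ∈ Finset.HasAntidiagonal.antidiagonal d, starHom k α (F p.1) (Q p.2) = 0
  refine Finset.sum_eq_zero fun p hp => ?_
  have hp' := Finset.HasAntidiagonal.mem_antidiagonal.1 hp
  rw [hF _ (by omega)]
  simp

/-- $P \mapsto \{P\}x$ intertwines $\Omega \ast \cdot$ with $\Omega \triangleright \cdot$ and sends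
the unit to $x$. -/
theorem brace_evalPowerSeries (φ : PowerSeries k) (Ω x : Completion k α) :
    brace (evalPowerSeries φ Ω.starLeft (PolyCompletion.unit k α)) x =
      evalPowerSeries φ Ω.preLieLeft x := by
  conv_rhs => rw [← brace_unit x]
  refine Ω.isRaising_starLeft.map_evalPowerSeries (braceRight x)
    (fun P => Ω.brace_starLeft x P) (fun d F hF => Subtype.ext ?_) φ _
  change ∑ p ∈ Finset.HasAntidiagonal.antidiagonal d, braceHom k α (F p.1) (x p.2) = 0
  refine Finset.sum_eq_zero fun p hp => ?_
  have hp' := Finset.HasAntidiagonal.mem_antidiagonal.1 hp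
  rw [hF _ (by omega)]
  simp

theorem power_star_evalPowerSeries (ψ : PowerSeries k) (Ω : Completion k α) (n : ℕ) :
    PolyCompletion.power PolyCompletion.star
        (evalPowerSeries ψ Ω.starLeft (PolyCompletion.unit k α)) n =
      evalPowerSeries (ψ ^ n) Ω.starLeft (PolyCompletion.unit k α) := by
  induction n with
  | zero => rw [pow_zero, Ω.isRaising_starLeft.evalPowerSeries_one]; rfl
  | succ n ih =>
    rw [PolyCompletion.power, ih, star_evalPowerSeries, PolyCompletion.unit_star, pow_succ,
      Ω.isRaising_starLeft.evalPowerSeries_mul, Module.End.mul_apply]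

theorem evalSeries_star_evalPowerSeries (φ : PowerSeries k) {ψ : PowerSeries k}
    (hψ : PowerSeries.constantCoeff ψ = 0) (Ω : Completion k α) :
    PolyCompletion.evalSeries PolyCompletion.star φ
        (evalPowerSeries ψ Ω.starLeft (PolyCompletion.unit k α)) =
      evalPowerSeries (φ.subst ψ) Ω.starLeft (PolyCompletion.unit k α) := by
  funext d
  rw [Ω.isRaising_starLeft.evalPowerSeries_subst hψ]
  simp only [PolyCompletion.evalSeries, power_star_evalPowerSeries]

theorem evalSeries_star_toPoly (φ : PowerSeries k) (Ω : Completion k α) :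
    PolyCompletion.evalSeries PolyCompletion.star φ Ω.toPoly =
      evalPowerSeries φ Ω.starLeft (PolyCompletion.unit k α) := by
  have h := evalSeries_star_evalPowerSeries φ (PowerSeries.constantCoeff_X (R := k)) Ω
  rwa [Ω.isRaising_starLeft.evalPowerSeries_X, starLeft_unit, ← PowerSeries.map_algebraMap_eq_subst_X,
    Algebra.algebraMap_self, PowerSeries.map_id] at h

end Completion

end TreePreLie

/-! ### Comparison of the exponentials for $\ast$ and $\circ$ -/

namespace TreePreLie

open DecoratedTree LeftPreLieRing Module.End

variable {k : Type*} [Field k] {α : Type*}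

namespace PolyCompletion

/-- An element of the completion of `k[V]` as a formal power series with coefficients in `k[V]`. -/
noncomputable def toPowerSeries (P : PolyCompletion k α) :
    PowerSeries (MvPolynomial (DecoratedTree α) k) :=
  PowerSeries.mk fun n => P n

@[simp] theorem coeff_toPowerSeries (P : PolyCompletion k α) (n : ℕ) :
    PowerSeries.coeff n P.toPowerSeries = P n := PowerSeries.coeff_mk _ _

theorem toPowerSeries_unit : (unit k α).toPowerSeries = 1 := by
  ext1 n
  rw [coeff_toPowerSeries, coe_unit, PowerSeries.coeff_one]

theorem toPowerSeries_power_circ (P : PolyCompletion k α) (n : ℕ) :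
    (power circ P n).toPowerSeries = P.toPowerSeries ^ n := by
  induction n with
  | zero => rw [pow_zero]; exact toPowerSeries_unit
  | succ n ih =>
    rw [pow_succ, ← ih]
    ext1 m
    rw [PowerSeries.coeff_mul, coeff_toPowerSeries, power, coe_circ]
    simp only [coeff_toPowerSeries]

end PolyCompletion

namespace Completion

/-- The derivation which extends the pre-Lie product by an element of the completion, with the
components of degree `> N` of this element omitted. -/
noncomputable def seriesDerivation (Ω : Completion k α) (N : ℕ) :
    Derivation k (PowerSeries (MvPolynomial (DecoratedTree α) k))
      (PowerSeries (MvPolynomial (DecoratedTree α) k)) :=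
  ∑ i ∈ Finset.range (N + 1), (PowerSeries.X : PowerSeries (MvPolynomial (DecoratedTree α) k)) ^ i •
    PowerSeries.coeffDerivation (graftDer (Ω i : TreePreLie k α))

/-- The factor $X^i$ records the degree of the component $\Omega_i$; components of degree $> N$ are
invisible in degrees $\le N$. -/
theorem coeff_seriesDerivation (Ω : Completion k α) {N d : ℕ} (hd : d ≤ N)
    (F : PowerSeries (MvPolynomial (DecoratedTree α) k)) :
    PowerSeries.coeff d (Ω.seriesDerivation N F) =
      ∑ p ∈ Finset.HasAntidiagonal.antidiagonal d,
        graftDer (Ω p.1 : TreePreLie k α) (PowerSeries.coeff p.2 F) := by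
  rw [Finset.Nat.sum_antidiagonal_eq_sum_range_succ
      (fun i j => graftDer (Ω i : TreePreLie k α) (PowerSeries.coeff j F)), seriesDerivation]
  have hsum : ∀ (s : Finset ℕ) (D : ℕ → Derivation k (PowerSeries (MvPolynomial (DecoratedTree α) k))
      (PowerSeries (MvPolynomial (DecoratedTree α) k))), (∑ i ∈ s, D i) F = ∑ i ∈ s, D i F :=
    fun s D => (congrFun (map_sum Derivation.coeFnAddMonoidHom D s) F).trans
      (Finset.sum_apply _ _ _)
  rw [hsum, map_sum]
  refine (Finset.sum_subset (Finset.range_subset_range.2 (by omega)) fun i _ hi => ?_).symm.trans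
    (Finset.sum_congr rfl fun i hi => ?_)
  · rw [Derivation.smul_apply, smul_eq_mul, PowerSeries.coeff_X_pow_mul', if_neg]
    simpa using hi
  · rw [Derivation.smul_apply, smul_eq_mul, PowerSeries.coeff_X_pow_mul',
      if_pos (by simpa [Nat.lt_succ_iff] using hi), PowerSeries.coeff_coeffDerivation]

theorem coeff_pow_mulLeft_add_seriesDerivation (Ω : Completion k α) (N n : ℕ) {d : ℕ}
    (hd : d ≤ N) :
    PowerSeries.coeff d (((LinearMap.mulLeft k Ω.toPoly.toPowerSeries +
      (Ω.seriesDerivation N : _ →ₗ[k] _) : Module.End k _) ^ n) 1) =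
      ((Ω.starLeft ^ n) (PolyCompletion.unit k α) d : MvPolynomial (DecoratedTree α) k) := by
  induction n generalizing d with
  | zero =>
    rw [pow_zero, pow_zero, Module.End.one_apply, Module.End.one_apply, PolyCompletion.coe_unit,
      PowerSeries.coeff_one]
  | succ n ih =>
    rw [pow_succ', pow_succ', Module.End.mul_apply, Module.End.mul_apply, coe_starLeft,
      LinearMap.add_apply, map_add, LinearMap.mulLeft_apply, PowerSeries.coeff_mul,
      Derivation.coeFn_coe, coeff_seriesDerivation _ hd, ← Finset.sum_add_distrib]
    refine Finset.sum_congr rfl fun p hp => ?_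
    have hp' := Finset.HasAntidiagonal.mem_antidiagonal.1 hp
    rw [ih (by omega), PolyCompletion.coeff_toPowerSeries, leftMul_apply]
    rfl

/-- On series with coefficients in $V$ the derivation is the pre-Lie product with $\Omega$, so its
iterates on $\Omega$ never leave $V$. -/
theorem coeff_iterate_seriesDerivation (Ω : Completion k α) (N n : ℕ) {d : ℕ} (hd : d ≤ N) :
    PowerSeries.coeff d ((Ω.seriesDerivation N)^[n] Ω.toPoly.toPowerSeries) =
      TreePreLie.toPoly k α ((Ω.preLieLeft ^ n) Ω d : TreePreLie k α) := by
  induction n generalizing d with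
  | zero => rw [Function.iterate_zero, id, PolyCompletion.coeff_toPowerSeries]; rfl
  | succ n ih =>
    rw [Function.iterate_succ_apply', coeff_seriesDerivation _ hd, pow_succ',
      Module.End.mul_apply, coe_preLieLeft, map_sum]
    refine Finset.sum_congr rfl fun p hp => ?_
    have hp' := Finset.HasAntidiagonal.mem_antidiagonal.1 hp
    rw [ih (by omega), graftDer_toPoly, mul_def]

/-- $\Omega$ itself starts in degree $1$, which yields one degree more than the number of
applications. -/
theorem pow_preLieLeft_apply_eq_zero (Ω : Completion k α) {n d : ℕ} (h : d < n + 1) :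
    (Ω.preLieLeft ^ n) Ω d = 0 := by
  refine Ω.isRaising_preLieLeft.pow_apply_eq_zero n (d := 1) (fun j hj => ?_) (by omega)
  obtain rfl : j = 0 := by omega
  exact Ω.apply_zero

section

variable [CharZero k]

open Nat PowerSeries

/-- The series `(exp X - 1) / X`. -/
noncomputable def expSubOneDivX (k : Type*) [Field k] : PowerSeries k :=
  PowerSeries.mk fun n => ((n + 1)! : k)⁻¹

omit [CharZero k] in
theorem coeff_exp_eq [Algebra ℚ k] (n : ℕ) : coeff n (exp k) = (n ! : k)⁻¹ := by
  simp [coeff_exp]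

theorem X_mul_expSubOneDivX : X * expSubOneDivX k = exp k - 1 := by
  ext n
  cases n with
  | zero => simp
  | succ n =>
    rw [coeff_succ_X_mul, expSubOneDivX, coeff_mk, map_sub, coeff_exp_eq, coeff_one,
      if_neg (Nat.succ_ne_zero n), sub_zero]

theorem bernoulliPowerSeries_mul_expSubOneDivX :
    bernoulliPowerSeries k * expSubOneDivX k = 1 := by
  refine mul_left_cancel₀ (X_ne_zero (R := k)) ?_
  rw [mul_left_comm, X_mul_expSubOneDivX, bernoulliPowerSeries_mul_exp_sub_one, mul_one]

-- The coefficient of index $n+1$ is $L^n\Omega/(n+1)!$, which starts in degree $n+1$. This permits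
-- setting the outer variable equal to $1$.
omit [CharZero k] in
theorem isDiagonal_derivationSeries (Ω : Completion k α) (N : ℕ) :
    IsDiagonal N (derivationSeries (Ω.seriesDerivation N) Ω.toPoly.toPowerSeries) := by
  intro n i h hi
  cases n with
  | zero => omega
  | succ n =>
    rw [coeff_succ_derivationSeries, coeff_smul, coeff_iterate_seriesDerivation _ _ _ hi,
      pow_preLieLeft_apply_eq_zero _ h, Submodule.coe_zero, map_zero, smul_zero]

omit [CharZero k] in
theorem coeff_coeffSum_derivationSeries (Ω : Completion k α) {N d : ℕ} (hd : d ≤ N) :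
    coeff d (coeffSum (derivationSeries (Ω.seriesDerivation N) Ω.toPoly.toPowerSeries)) =
      coeff d (Completion.toPoly
        (evalPowerSeries (expSubOneDivX k) Ω.preLieLeft Ω)).toPowerSeries := by
  rw [coeffSum, coeff_mk, Finset.sum_range_succ', coeff_zero_eq_constantCoeff_apply
    (derivationSeries (Ω.seriesDerivation N) Ω.toPoly.toPowerSeries),
    constantCoeff_derivationSeries, map_zero, add_zero, PolyCompletion.coeff_toPowerSeries]
  change _ = TreePreLie.toPoly k α (evalPowerSeries (expSubOneDivX k) Ω.preLieLeft Ω d)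
  -- The index shift leaves `d` terms on the left; the extra term $L^d\Omega$ on the right vanishes
  -- in degree $d$.
  rw [evalPowerSeries_apply_eq_sum, Finset.sum_range_succ, pow_preLieLeft_apply_eq_zero _
    (Nat.lt_succ_self d), smul_zero, add_zero, Submodule.coe_sum, map_sum]
  refine Finset.sum_congr rfl fun n _ => ?_
  rw [coeff_succ_derivationSeries, coeff_smul, coeff_iterate_seriesDerivation _ _ _ hd,
    expSubOneDivX, coeff_mk, Submodule.coe_smul, map_smul]

/-- The exponential of `Ω` for the product `∗` is the exponential for the commutative product of
`∑ₙ Lⁿ Ω / (n + 1)!`, where `L` is the left pre-Lie product with `Ω`. -/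
theorem evalPowerSeries_exp_starLeft (Ω : Completion k α) :
    evalPowerSeries (exp k) Ω.starLeft (PolyCompletion.unit k α) =
      PolyCompletion.expCirc
        (Completion.toPoly (evalPowerSeries (expSubOneDivX k) Ω.preLieLeft Ω)) := by
  set y : Completion k α := evalPowerSeries (expSubOneDivX k) Ω.preLieLeft Ω
  refine funext fun d => Subtype.ext ?_
  -- The outer variable of `Y` is the time $t$, the inner one records the number of vertices. The
  -- truncation level is the degree `d` being compared.
  set Y := derivationSeries (Ω.seriesDerivation d) Ω.toPoly.toPowerSeries
  have hdiag : IsDiagonal d Y := isDiagonal_derivationSeries Ω d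
  -- Setting $t = 1$ turns $Y$ into $y$, hence $Y^m$ into $y^m$, up to degree $d$.
  have hpow : ∀ m, ∑ n ∈ Finset.range (d + 1), coeff d (coeff n (Y ^ m)) =
      (PolyCompletion.power PolyCompletion.circ y.toPoly m d :
        MvPolynomial (DecoratedTree α) k) := by
    intro m
    rw [← PolyCompletion.coeff_toPowerSeries, PolyCompletion.toPowerSeries_power_circ,
      ← (hdiag.pow m).coeff_coeffSum le_rfl le_rfl, hdiag.coeff_coeffSum_pow m le_rfl]
    have htrunc : ∀ (a b : PowerSeries (MvPolynomial (DecoratedTree α) k)),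
        (∀ j ≤ d, coeff j a = coeff j b) → ∀ j ≤ d, coeff j (a ^ m) = coeff j (b ^ m) := by
      intro a b hab
      induction m with
      | zero => simp
      | succ m ih =>
        intro j hj
        rw [_root_.pow_succ, _root_.pow_succ, coeff_mul, coeff_mul]
        refine Finset.sum_congr rfl fun p hp => ?_
        have hp' := Finset.HasAntidiagonal.mem_antidiagonal.1 hp
        rw [ih p.1 (by omega), hab p.2 (by omega)]
    exact htrunc _ _ (fun j hj => Ω.coeff_coeffSum_derivationSeries hj) d le_rfl
  rw [evalPowerSeries_apply_eq_sum, PolyCompletion.expCirc, PolyCompletion.evalSeries,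
    Submodule.coe_sum, Submodule.coe_sum]
  simp only [Submodule.coe_smul, coeff_exp_eq, ← hpow, Finset.smul_sum]
  -- With the sum over powers of $t$ outermost, the terms match one by one: the coefficient of $t^n$
  -- in $\exp Y$ is $M^n 1/n!$.
  rw [Finset.sum_comm]
  refine Finset.sum_congr rfl fun n hn => ?_
  have h := congrArg (coeff d) (coeff_expPartial_derivationSeries (k := k) (Ω.seriesDerivation d)
    Ω.toPoly.toPowerSeries (Nat.lt_succ_iff.1 (Finset.mem_range.1 hn)))
  rw [coeff_smul, coeff_pow_mulLeft_add_seriesDerivation _ _ _ le_rfl] at h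
  rw [← h, expPartial, map_sum, map_sum]
  simp only [coeff_smul]
  rfl

/-! ### The Magnus equation -/

theorem isMagnusElement_iff (x Ω : Completion k α) :
    IsMagnusElement x Ω ↔ evalPowerSeries (bernoulliPowerSeries k) Ω.preLieLeft x = Ω := by
  rw [IsMagnusElement, evalSeries_star_toPoly, brace_evalPowerSeries]

/-- Inverting the Bernoulli series in $L$ expresses $x$ as $\frac{e^L-1}{L}\Omega$. Then
$\exp^\circ(x)$ is the exponential of $\Omega$ for $\ast$, and the logarithm undoes it at the level
of power series. -/
theorem toPoly_eq_logStar_expCirc {x Ω : Completion k α} (h : IsMagnusElement x Ω) :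
    Ω.toPoly = PolyCompletion.logStar (PolyCompletion.expCirc x.toPoly) := by
  have hx : evalPowerSeries (expSubOneDivX k) Ω.preLieLeft Ω = x := by
    have h2 := congrArg (evalPowerSeries (expSubOneDivX k) Ω.preLieLeft)
      ((isMagnusElement_iff x Ω).1 h)
    rw [← Module.End.mul_apply, ← Ω.isRaising_preLieLeft.evalPowerSeries_mul, mul_comm,
      bernoulliPowerSeries_mul_expSubOneDivX, Ω.isRaising_preLieLeft.evalPowerSeries_one] at h2
    exact h2.symm
  rw [← hx, ← evalPowerSeries_exp_starLeft, PolyCompletion.logStar]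
  have h1 : evalPowerSeries (exp k) Ω.starLeft (PolyCompletion.unit k α) -
      PolyCompletion.unit k α =
        evalPowerSeries (exp k - 1) Ω.starLeft (PolyCompletion.unit k α) := by
    rw [evalPowerSeries_sub, Ω.isRaising_starLeft.evalPowerSeries_one]
    rfl
  rw [h1, evalSeries_star_evalPowerSeries _ (by simp), log_subst_exp_sub_one,
    Ω.isRaising_starLeft.evalPowerSeries_X, starLeft_unit]

omit [CharZero k] in
theorem power_star_congr {P Q : PolyCompletion k α} {d : ℕ} (h : ∀ j ≤ d, P j = Q j) (n : ℕ) {j : ℕ}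
    (hj : j ≤ d) : PolyCompletion.power PolyCompletion.star P n j =
      PolyCompletion.power PolyCompletion.star Q n j := by
  induction n generalizing j with
  | zero => rfl
  | succ n ih =>
    refine Subtype.ext ?_
    rw [PolyCompletion.power, PolyCompletion.power, PolyCompletion.coe_star,
      PolyCompletion.coe_star]
    refine Finset.sum_congr rfl fun p hp => ?_
    have hp' := Finset.HasAntidiagonal.mem_antidiagonal.1 hp
    rw [ih (by omega), h p.2 (by omega)]

theorem existsUnique_isMagnusElement (x : Completion k α) : ∃! Ω, IsMagnusElement x Ω := by
  refine exists_unique_fixedPoint (V := fun n => gradedPiece k α n) _ fun d (F G : Completion k α) h =>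
    Subtype.ext ?_
  rw [coe_brace, coe_brace]
  refine Finset.sum_congr rfl fun p hp => ?_
  have hp' := Finset.HasAntidiagonal.mem_antidiagonal.1 hp
  -- As $x$ has no component of degree $0$, the Bernoulli series only matters in degrees $< d$,
  -- where it depends only on components of $\Omega$ of degree $< d$.
  by_cases h0 : p.2 = 0
  · rw [h0, x.apply_zero, Submodule.coe_zero, map_zero, map_zero]
  · have hFG : ∀ j ≤ p.1, F.toPoly j = G.toPoly j := fun j hj =>
      Subtype.ext (congrArg (fun v : gradedPiece k α j => TreePreLie.toPoly k α v)
        (h j (by omega)))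
    simp only [PolyCompletion.evalSeries, power_star_congr hFG _ le_rfl]

end

end Completion

end TreePreLie

theorem mainTheorem3 {k : Type*} [Field k] [CharZero k] {α : Type*}
    (x : TreePreLie.Completion k α) :
    ∃ Ω : TreePreLie.Completion k α,
      TreePreLie.IsMagnusElement x Ω ∧
      (∀ Ω' : TreePreLie.Completion k α, TreePreLie.IsMagnusElement x Ω' → Ω' = Ω) ∧
      Ω.toPoly = TreePreLie.PolyCompletion.logStar (TreePreLie.PolyCompletion.expCirc x.toPoly) := by
  obtain ⟨Ω, h, huniq⟩ := TreePreLie.Completion.existsUnique_isMagnusElement x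
  exact ⟨Ω, h, huniq, TreePreLie.Completion.toPoly_eq_logStar_expCirc h⟩
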